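/- Let $(M,g)$ be a Lorentz manifold, that is, a connected, Hausdorff, second-countable smooth manifold of finite dimension at least $2$ with a smooth metric $g$ of signature $(-,+,\dots,+)$; geodesics are those of the Levi-Civita connection. A tangent vector $v$ is timelike if $g(v,v)<0$, and causal if it is timelike or if $v\neq 0$ and $g(v,v)=0$; a geodesic (defined on a nondegenerate interval) is causal if its velocity is everywhere causal. A collection $\mathcal C$ of geodesics is *pseudoconvex* if for every compact $K\subset M$ there is a compact $K^*\subset M$ containing every segment, with endpoints in $K$, of a geodesic in $\mathcal C$. It is *disprisoning* if for every maximal extension $\gamma:(a,b)\to M$ of a geodesic in $\mathcal C$ and every $t_0\in(a,b)$, neither $\overline{\gamma([t_0,b))}$ nor $\overline{\gamma((a,t_0])}$ is compact. For $p\in M$ let $\mathcal D_p\subset T_pM$ be the maximal domain of the exponential map $\exp_p$ (the set of $v\in T_pM$ for which the geodesic with initial velocity $v$ is defined up to time $1$), let $\mathcal C_p$ be the closure in $T_pM$ of the set of timelike vectors at $p$, and let $C_p=\mathcal C_p\cap\mathcal D_p$. A map is *proper* if preimages of compact sets are compact. Then for every $p\in M$, the collection of all causal geodesics of $(M,g)$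 that pass through $p$, possibly after having been extended, is pseudoconvex and disprisoning if and only if $\exp_p|_{C_p}:C_p\to M$ is proper. In particular, if the collection of all causal geodesics of $(M,g)$ is pseudoconvex and disprisoning, then $\exp_q|_{C_q}$ is proper for every $q\in M$. -/

import Mathlib

open Set
open scoped Manifold ContDiff Topology

noncomputable section

/-- A smooth Lorentz metric on a smooth manifold `M` modelled on `E`: a smooth field of symmetric
bilinear forms on the tangent spaces, each of signature `(-, +, …, +)`. -/
structure LorentzMetric (E : Type*) [NormedAddCommGroup E] [NormedSpace ℝ E]
    (M : Type*) [TopologicalSpace M] [ChartedSpace E M] [IsManifold 𝓘(ℝ, E) ∞ M] where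
  /-- The bilinear form on each tangent space. -/
  val : ∀ x : M, TangentSpace 𝓘(ℝ, E) x →L[ℝ] TangentSpace 𝓘(ℝ, E) x →L[ℝ] ℝ
  symm : ∀ (x : M) (v w : TangentSpace 𝓘(ℝ, E) x), val x v w = val x w v
  /-- There is a negative vector whose orthogonal complement is positive definite. Thus the form
  is nondegenerate of index one. -/
  signature : ∀ x : M, ∃ v : TangentSpace 𝓘(ℝ, E) x, val x v v < 0 ∧
    ∀ w : TangentSpace 𝓘(ℝ, E) x, w ≠ 0 → val x v w = 0 → 0 < val x w w
  contMDiff : ContMDiff 𝓘(ℝ, E) (𝓘(ℝ, E).prod 𝓘(ℝ, E →L[ℝ] E →L[ℝ] ℝ)) ∞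
    (fun x ↦ Bundle.TotalSpace.mk' (E →L[ℝ] E →L[ℝ] ℝ) x (val x))

namespace LorentzMetric

variable {E : Type*} [NormedAddCommGroup E] [NormedSpace ℝ E]
  {M : Type*} [TopologicalSpace M] [ChartedSpace E M] [IsManifold 𝓘(ℝ, E) ∞ M]

/-! ### Causal character -/

/-- Timelike vectors: `g(v, v) < 0`. -/
def IsTimelike (g : LorentzMetric E M) {x : M} (v : TangentSpace 𝓘(ℝ, E) x) : Prop :=
  g.val x v v < 0

/-- Null (lightlike) vectors: `v ≠ 0` and `g(v, v) = 0`. -/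
def IsNull (g : LorentzMetric E M) {x : M} (v : TangentSpace 𝓘(ℝ, E) x) : Prop :=
  v ≠ 0 ∧ g.val x v v = 0

/-- Causal vectors: timelike or null. -/
def IsCausal (g : LorentzMetric E M) {x : M} (v : TangentSpace 𝓘(ℝ, E) x) : Prop :=
  g.IsTimelike v ∨ g.IsNull v

/-- The closed causal cone at `p`: the closure in `T_pM` of the set of timelike vectors. -/
def causalCone (g : LorentzMetric E M) (p : M) : Set (TangentSpace 𝓘(ℝ, E) p) :=
  closure {v | g.IsTimelike v}

/-! ### The Levi-Civita connection in charts -/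

/-- The coordinate expression of the metric in the chart `e`, at the point `x` of `e.target`:
`(u, v) ↦ g(d(e⁻¹)ₓ u, d(e⁻¹)ₓ v)`. -/
def inChart (g : LorentzMetric E M) (e : OpenPartialHomeomorph M E) (x : E) :
    E →L[ℝ] E →L[ℝ] ℝ :=
  ContinuousLinearMap.bilinearComp (E := E) (F := E) (g.val (e.symm x))
    (mfderiv 𝓘(ℝ, E) 𝓘(ℝ, E) e.symm x) (mfderiv 𝓘(ℝ, E) 𝓘(ℝ, E) e.symm x)

/-- Christoffel symbols of the first kind: the linear form
`w ↦ ½ (D_u g(v, w) + D_v g(u, w) - D_w g(u, v))`. -/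
def christoffelFirst (g : LorentzMetric E M) (e : OpenPartialHomeomorph M E) (x u v : E) :
    E →L[ℝ] ℝ :=
  (1 / 2 : ℝ) • (fderiv ℝ (g.inChart e) x u v + fderiv ℝ (g.inChart e) x v u
    - ((fderiv ℝ (g.inChart e) x).flip u).flip v)

/-- Christoffel symbols (of the second kind) of the Levi-Civita connection, as the vector
`Γ(u, v) = Γⁱⱼₖ uʲ vᵏ ∂ᵢ`: the index of the first-kind symbols is raised with the inverse of
the (invertible) map `E → E*` given by the metric. -/
def christoffel (g : LorentzMetric E M) (e : OpenPartialHomeomorph M E) (x u v : E) : E :=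
  (g.inChart e x).inverse (g.christoffelFirst e x u v)

/-! ### Geodesics -/

/-- `γ` is a geodesic on the open set `U ⊆ ℝ`: it is of class `C²` and in each chart `e` of the
atlas it satisfies `x'' + Γ(x', x') = 0`. (Solutions are then automatically smooth.) -/
def SolvesGeodesicEq (g : LorentzMetric E M) (γ : ℝ → M) (U : Set ℝ) : Prop :=
  ContMDiffOn 𝓘(ℝ, ℝ) 𝓘(ℝ, E) 2 γ U ∧
    ∀ e ∈ atlas E M, ∀ t ∈ U, γ t ∈ e.source →
      deriv (deriv (fun s ↦ e (γ s))) t +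
        g.christoffel e (e (γ t)) (deriv (fun s ↦ e (γ s)) t) (deriv (fun s ↦ e (γ s)) t) = 0

/-- `γ` is a geodesic on a set `s ⊆ ℝ` (in practice an interval, of any kind): as usual for curves
on intervals that are not open, it is the restriction of a geodesic on an open set. If `s` is open
this is the same as `SolvesGeodesicEq g γ s`. -/
def IsGeodesicOn (g : LorentzMetric E M) (γ : ℝ → M) (s : Set ℝ) : Prop :=
  ∃ (U : Set ℝ) (σ : ℝ → M), IsOpen U ∧ s ⊆ U ∧ EqOn γ σ s ∧ g.SolvesGeodesicEq σ U

/-- The velocity `γ'(t) ∈ TM` of a curve `γ` defined on the interval `s`. -/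
def velocity (γ : ℝ → M) (s : Set ℝ) (t : ℝ) : TangentBundle 𝓘(ℝ, E) M :=
  ⟨γ t, (mfderivWithin 𝓘(ℝ, ℝ) 𝓘(ℝ, E) γ s t : ℝ →L[ℝ] TangentSpace 𝓘(ℝ, E) (γ t)) 1⟩

/-- Geodesics of `(M, g)`, with their domain: a nondegenerate interval, which may be open, closed
or half-open, bounded or not. The values of `toFun` off `dom` are irrelevant. -/
structure Geodesic (g : LorentzMetric E M) where
  /-- The curve. -/
  toFun : ℝ → M
  /-- Its domain. -/
  dom : Set ℝ
  ordConnected : dom.OrdConnected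
  nontrivial : dom.Nontrivial
  isGeodesicOn : g.IsGeodesicOn toFun dom

namespace Geodesic

variable {g : LorentzMetric E M}

/-- `σ` is an extension of `γ`. -/
def Extends (σ γ : g.Geodesic) : Prop :=
  γ.dom ⊆ σ.dom ∧ EqOn σ.toFun γ.toFun γ.dom

/-- `γ` has no proper extension. -/
def IsMaximal (γ : g.Geodesic) : Prop :=
  ∀ σ : g.Geodesic, σ.Extends γ → σ.dom ⊆ γ.dom

/-- `γ` is a causal geodesic: its velocity is causal at every point. -/
def IsCausal (γ : g.Geodesic) : Prop :=
  ∀ t ∈ γ.dom, g.IsCausal (velocity (E := E) γ.toFun γ.dom t).2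

end Geodesic

/-- A collection of geodesics is pseudoconvex if for each compact `K` there is a compact `K'` that
contains every segment, with endpoints in `K`, of a geodesic of the collection. -/
def Pseudoconvex {g : LorentzMetric E M} (C : Set g.Geodesic) : Prop :=
  ∀ K : Set M, IsCompact K → ∃ K' : Set M, IsCompact K' ∧
    ∀ γ ∈ C, ∀ a b : ℝ, a ≤ b → Icc a b ⊆ γ.dom → γ.toFun a ∈ K → γ.toFun b ∈ K →
      γ.toFun '' Icc a b ⊆ K'

/-- A collection of geodesics is disprisoning if for each maximal extension `σ : (a, b) → M` of a
geodesic of the collection and each `t₀ ∈ (a, b)`, neither the closure of `σ [t₀, b)` nor that of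
`σ (a, t₀]` is compact. -/
def Disprisoning {g : LorentzMetric E M} (C : Set g.Geodesic) : Prop :=
  ∀ γ ∈ C, ∀ σ : g.Geodesic, σ.Extends γ → σ.IsMaximal → ∀ t₀ ∈ σ.dom,
    ¬ IsCompact (closure (σ.toFun '' (σ.dom ∩ Ici t₀))) ∧
    ¬ IsCompact (closure (σ.toFun '' (σ.dom ∩ Iic t₀)))

/-- All causal geodesics of `(M, g)`. -/
def causalGeodesics (g : LorentzMetric E M) : Set g.Geodesic :=
  {γ | γ.IsCausal}

/-- The causal geodesics through `p`, up to extensions: those causal geodesics that pass through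
`p`, possibly after having been extended. -/
def causalGeodesicsThrough (g : LorentzMetric E M) (p : M) : Set g.Geodesic :=
  {γ | γ.IsCausal ∧ ∃ σ : g.Geodesic, σ.Extends γ ∧ p ∈ σ.toFun '' σ.dom}

/-! ### The exponential map -/

/-- `γ` is a geodesic on `[0, 1]` with initial velocity `v ∈ T_pM` (so in particular `γ 0 = p`). -/
def IsExpGeodesic (g : LorentzMetric E M) (p : M) (v : TangentSpace 𝓘(ℝ, E) p)
    (γ : ℝ → M) : Prop :=
  g.IsGeodesicOn γ (Icc 0 1) ∧ velocity γ (Icc 0 1) 0 = (⟨p, v⟩ : TangentBundle 𝓘(ℝ, E) M)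

/-- The maximal domain `D_p ⊆ T_pM` of `exp_p`: the vectors `v` for which the geodesic with initial
velocity `v` is defined up to time `1`. -/
def expDomain (g : LorentzMetric E M) (p : M) : Set (TangentSpace 𝓘(ℝ, E) p) :=
  {v | ∃ γ : ℝ → M, g.IsExpGeodesic p v γ}

open Classical in
/-- The exponential map at `p`: `exp_p v = γ 1`, where `γ` is the geodesic on `[0, 1]` with initial
velocity `v` (unique on `[0, 1]` if `M` is Hausdorff). It is meant on `expDomain g p` only. -/
def exp (g : LorentzMetric E M) (p : M) (v : TangentSpace 𝓘(ℝ, E) p) : M :=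
  if h : ∃ γ : ℝ → M, g.IsExpGeodesic p v γ then h.choose 1 else p

/-- The set `C_p`: the part of the closed causal cone in the domain of `exp_p`. -/
def causalExpDomain (g : LorentzMetric E M) (p : M) : Set (TangentSpace 𝓘(ℝ, E) p) :=
  g.causalCone p ∩ g.expDomain p

/-- `exp_p` restricted to `C_p`, as a map on the subspace `C_p` of `T_pM`. -/
def causalExp (g : LorentzMetric E M) (p : M) : g.causalExpDomain p → M :=
  fun v ↦ g.exp p v

end LorentzMetric

/-- A map is proper if preimages of compact sets are compact. -/
def HasCompactPreimages {X Y : Type*} [TopologicalSpace X] [TopologicalSpace Y]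
    (f : X → Y) : Prop :=
  ∀ K : Set Y, IsCompact K → IsCompact (f ⁻¹' K)

end

noncomputable section

set_option maxSynthPendingDepth 3
set_option linter.unusedSectionVars false

namespace LorentzMetric

variable {E : Type*} [NormedAddCommGroup E] [NormedSpace ℝ E]
  {M : Type*} [TopologicalSpace M] [ChartedSpace E M] [IsManifold 𝓘(ℝ, E) ∞ M]
  {g : LorentzMetric E M} {e e' : OpenPartialHomeomorph M E}

/-! The analytic input is the ODE theory of geodesics: uniqueness and continuous dependence make
`D_p` open and star-shaped about 0, and `exp_p` continuous on it. A causal geodesic stays causal,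
since `g(γ', γ')` is constant and the velocity cannot vanish. Hence each geodesic of the collection
extends to `t ↦ exp_p((t - s)v)` with `v` causal (`exists_extension_through`), and everything
reduces to the sets `A = {v ∈ C_p | exp_p v ∈ K}` (`causalPreimage`).

Let `exp_p` be proper on `C_p`. If an end of a causal geodesic through `p` were trapped in a compact
set, the vectors `tv` of `D_p` with `t ≥ 0` (or those with `t ≤ 0`) would lie in some compact `A`.
They would be bounded, their supremum would again lie in `D_p`, and openness of `D_p` would prolong
the ray (`not_imprisoned_of_isCompact`). For pseudoconvexity, the union of the radial segments from
0 to a compact `A` is compact, and its image under `exp_p` contains all segments with endpoints in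
`K`.

Conversely, pseudoconvexity traps all curves `exp_p(tw)`, for `w ∈ A` and `0 ≤ t ≤ 1`, in one
compact set. If `A` had a limit point outside `D_p`, or were unbounded, then the maximal ray along
that limit point, or along a limit of directions, would be a limit of trapped segments and so be
trapped itself, against disprisonment (`not_imprisoned_of_disprisoning`). Limit points inside `D_p`
belong to `A` by continuity of `exp_p`. -/

theorem two_le_infty : (2 : ℕ∞ω) ≤ ∞ :=
  WithTop.coe_le_coe.2 (le_top : (2 : ℕ∞) ≤ ⊤)

/-! ### The metric and the geodesic field in a chart -/

/-- The metric is nondegenerate. -/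
theorem eq_zero_of_val_eq_zero (g : LorentzMetric E M) {x : M} {u : TangentSpace 𝓘(ℝ, E) x}
    (hu : ∀ w, g.val x u w = 0) : u = 0 := by
  obtain ⟨v, hv, hpos⟩ := g.signature x
  have hw : u - (g.val x v u / g.val x v v) • v = 0 := by
    by_contra hne
    have h1 : g.val x v (u - (g.val x v u / g.val x v v) • v) = 0 := by
      rw [map_sub, map_smul, smul_eq_mul, div_mul_cancel₀ _ hv.ne, sub_self]
    have h2 := hpos _ hne h1
    rw [map_sub, map_smul, g.symm _ _ u, hu, g.symm x (_ - _) v, h1] at h2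
    simp at h2
  have h3 : g.val x v u = 0 := by rw [g.symm, hu]
  rw [h3] at hw
  simpa using hw

theorem contMDiffOn_symm_of_atlas (he : e ∈ atlas E M) :
    ContMDiffOn 𝓘(ℝ, E) 𝓘(ℝ, E) ∞ e.symm e.target :=
  contMDiffOn_symm_of_mem_maximalAtlas (IsManifold.subset_maximalAtlas he)

theorem contMDiffOn_coordField (he : e ∈ atlas E M) (u : E) :
    ContMDiffOn 𝓘(ℝ, E) (𝓘(ℝ, E).prod 𝓘(ℝ, E)) ∞
      (fun x : E ↦ (⟨e.symm x, (mfderiv 𝓘(ℝ, E) 𝓘(ℝ, E) e.symm x :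
        E →L[ℝ] TangentSpace 𝓘(ℝ, E) (e.symm x)) u⟩ :
        TangentBundle 𝓘(ℝ, E) M)) e.target := by
  have h1 : ContMDiffOn 𝓘(ℝ, E) 𝓘(ℝ, E) ∞ e.symm e.target := contMDiffOn_symm_of_atlas he
  have h2 := h1.contMDiffOn_tangentMapWithin (m := ∞) (by simp) e.open_target.uniqueMDiffOn
  have h3 : ContMDiff 𝓘(ℝ, E) 𝓘(ℝ, E).tangent ∞
      (fun x : E ↦ (⟨x, u⟩ : TangentBundle 𝓘(ℝ, E) E)) := by
    have := (contMDiff_vectorSpace_iff_contDiff (𝕜 := ℝ) (n := ∞) (E := E)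
      (V := fun _ ↦ u)).2 contDiff_const
    exact this
  have h4 := h2.comp (s := e.target) h3.contMDiffOn (fun x hx ↦ hx)
  refine h4.congr fun x hx ↦ ?_
  simp only [Function.comp, tangentMapWithin]
  rw [mfderivWithin_of_isOpen e.open_target hx]

theorem contMDiffOn_inChart_apply (g : LorentzMetric E M) (he : e ∈ atlas E M) (u v : E) :
    ContMDiffOn 𝓘(ℝ, E) 𝓘(ℝ, ℝ) ∞ (fun x ↦ g.inChart e x u v) e.target := by
  intro x hx
  have hu := contMDiffOn_coordField he u x hx
  have hv := contMDiffOn_coordField he v x hx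
  have hg := g.contMDiff.contMDiffAt.comp_contMDiffWithinAt x (contMDiffOn_symm_of_atlas he x hx)
  have h := ContMDiffWithinAt.clm_bundle_apply₂ (E₃ := Bundle.Trivial M ℝ) (F₃ := ℝ)
    (b := e.symm) hg hu hv
  exact (Bundle.contMDiffWithinAt_totalSpace.1 h).2

theorem contDiffOn_inChart [FiniteDimensional ℝ E] (g : LorentzMetric E M) (he : e ∈ atlas E M) :
    ContDiffOn ℝ ∞ (g.inChart e) e.target := by
  rw [contDiffOn_clm_apply]
  intro u
  rw [contDiffOn_clm_apply]
  intro v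
  exact (contMDiffOn_inChart_apply g he u v).contDiffOn

theorem inChart_apply (g : LorentzMetric E M) (e : OpenPartialHomeomorph M E) (x u v : E) :
    g.inChart e x u v = g.val (e.symm x)
      ((mfderiv 𝓘(ℝ, E) 𝓘(ℝ, E) e.symm x : E →L[ℝ] TangentSpace 𝓘(ℝ, E) (e.symm x)) u)
      ((mfderiv 𝓘(ℝ, E) 𝓘(ℝ, E) e.symm x : E →L[ℝ] TangentSpace 𝓘(ℝ, E) (e.symm x)) v) := by
  rfl

theorem inChart_symm (g : LorentzMetric E M) (e : OpenPartialHomeomorph M E) (x u v : E) :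
    g.inChart e x u v = g.inChart e x v u := by
  rw [inChart_apply, inChart_apply, g.symm]

theorem mdifferentiable_of_atlas (he : e ∈ atlas E M) : e.MDifferentiable 𝓘(ℝ, E) 𝓘(ℝ, E) :=
  mdifferentiable_of_mem_atlas he

/-- Nondegeneracy gives injectivity, and `E` and its dual have the same finite dimension. Without
this, `christoffel` would only see the default value of `inverse`. -/
theorem inChart_isInvertible [FiniteDimensional ℝ E] (g : LorentzMetric E M) (he : e ∈ atlas E M)
    {x : E} (hx : x ∈ e.target) : (g.inChart e x).IsInvertible := by
  have hinj : Function.Injective (g.inChart e x) := by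
    rw [injective_iff_map_eq_zero]
    intro u hu
    have hs : Function.Surjective (mfderiv 𝓘(ℝ, E) 𝓘(ℝ, E) e.symm x) :=
      (mdifferentiable_of_atlas he).symm.mfderiv_surjective hx
    have hi : Function.Injective (mfderiv 𝓘(ℝ, E) 𝓘(ℝ, E) e.symm x) :=
      (mdifferentiable_of_atlas he).symm.mfderiv_injective hx
    have h0 : mfderiv 𝓘(ℝ, E) 𝓘(ℝ, E) e.symm x u = 0 := by
      apply g.eq_zero_of_val_eq_zero
      intro w
      obtain ⟨w, rfl⟩ := hs w
      have := congrArg (fun L : E →L[ℝ] ℝ ↦ L w) hu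
      exact this
    exact hi (h0.trans (map_zero _).symm)
  have hfin : Module.finrank ℝ E = Module.finrank ℝ (E →L[ℝ] ℝ) := by
    rw [← (LinearMap.toContinuousLinearMap (𝕜 := ℝ) (E := E) (F' := ℝ)).finrank_eq]
    exact (Subspace.dual_finrank_eq).symm
  have hbij := ((g.inChart e x : E →ₗ[ℝ] (E →L[ℝ] ℝ)).injective_iff_surjective_of_finrank_eq_finrank
    hfin).1 hinj
  exact ⟨(LinearEquiv.ofBijective (g.inChart e x : E →ₗ[ℝ] (E →L[ℝ] ℝ))
    ⟨hinj, hbij⟩).toContinuousLinearEquiv, by ext; rfl⟩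

theorem inChart_christoffel [FiniteDimensional ℝ E] (g : LorentzMetric E M) (he : e ∈ atlas E M)
    {x : E} (hx : x ∈ e.target) (u v : E) :
    g.inChart e x (g.christoffel e x u v) = g.christoffelFirst e x u v := by
  obtain ⟨A, hA⟩ := inChart_isInvertible g he hx
  rw [christoffel, ← hA, ContinuousLinearMap.inverse_equiv]
  exact A.apply_symm_apply _

theorem christoffelFirst_apply (g : LorentzMetric E M) (e : OpenPartialHomeomorph M E)
    (x u w : E) : g.christoffelFirst e x u u w =
      fderiv ℝ (g.inChart e) x u u w - (1 / 2) * fderiv ℝ (g.inChart e) x w u u := by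
  simp [christoffelFirst]
  ring

/-- Lowering the index removes the inverse metric, so that the change of charts only involves the
metric and its first derivative. -/
theorem add_christoffel_eq_zero_iff [FiniteDimensional ℝ E] (g : LorentzMetric E M)
    (he : e ∈ atlas E M) {x : E} (hx : x ∈ e.target) (a u : E) :
    a + g.christoffel e x u u = 0 ↔
      ∀ w, g.inChart e x a w + (fderiv ℝ (g.inChart e) x u u w
        - (1 / 2) * fderiv ℝ (g.inChart e) x w u u) = 0 := by
  have key : ∀ w, g.inChart e x (a + g.christoffel e x u u) w =
      g.inChart e x a w + (fderiv ℝ (g.inChart e) x u u w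
        - (1 / 2) * fderiv ℝ (g.inChart e) x w u u) := by
    intro w
    rw [map_add, inChart_christoffel g he hx, ← christoffelFirst_apply]
    rfl
  simp_rw [← key]
  constructor
  · intro h w
    rw [h]; simp
  · intro h
    obtain ⟨A, hA⟩ := inChart_isInvertible g he hx
    have h1 : A (a + g.christoffel e x u u) = 0 := by
      ext w
      have := h w
      rw [← hA] at this
      exact this
    exact A.map_eq_zero_iff.1 h1

/-- The vector field on `E × E` whose integral curves are the geodesics, with their velocities, in
the chart `e`. -/
def geodesicField (g : LorentzMetric E M) (e : OpenPartialHomeomorph M E) (z : E × E) : E × E :=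
  (z.2, -g.christoffel e z.1 z.2 z.2)

/-- Inversion of operators is smooth at invertible ones, so the Christoffel symbols are regular.
Class `C¹` is all that Picard–Lindelöf needs. -/
theorem contDiffOn_geodesicField [FiniteDimensional ℝ E] (g : LorentzMetric E M)
    (he : e ∈ atlas E M) : ContDiffOn ℝ 1 (g.geodesicField e) (e.target ×ˢ univ) := by
  have := FiniteDimensional.complete ℝ E
  have hfst : ContDiffOn ℝ 1 (Prod.fst : E × E → E) (e.target ×ˢ univ) := contDiff_fst.contDiffOn
  have hsnd : ContDiffOn ℝ 1 (Prod.snd : E × E → E) (e.target ×ˢ univ) := contDiff_snd.contDiffOn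
  have hmaps : MapsTo (Prod.fst : E × E → E) (e.target ×ˢ univ) e.target := fun z hz ↦ hz.1
  have hh := contDiffOn_inChart g he
  have hd : ContDiffOn ℝ 1 (fderiv ℝ (g.inChart e)) e.target :=
    (hh.fderiv_of_isOpen (m := ∞) e.open_target (by simp)).of_le (by exact_mod_cast le_top)
  have hd' : ContDiffOn ℝ 1 (fun z : E × E ↦ fderiv ℝ (g.inChart e) z.1) (e.target ×ˢ univ) :=
    hd.comp hfst hmaps
  have hinv : ContDiffOn ℝ 1 (fun z : E × E ↦ (g.inChart e z.1).inverse) (e.target ×ˢ univ) := by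
    have h1 : ContDiffOn ℝ 1 (fun x ↦ (g.inChart e x).inverse) e.target := by
      intro x hx
      obtain ⟨A, hA⟩ := inChart_isInvertible g he hx
      have := contDiffAt_map_inverse (𝕜 := ℝ) (n := 1) A
      rw [hA] at this
      exact this.comp_contDiffWithinAt x ((hh x hx).of_le (by exact_mod_cast le_top))
    exact h1.comp hfst hmaps
  have hfl : ContDiffOn ℝ 1 (fun z : E × E ↦
      ((fderiv ℝ (g.inChart e) z.1).flip z.2).flip z.2) (e.target ×ˢ univ) := by
    rw [contDiffOn_clm_apply]
    intro w
    exact ((hd'.clm_apply contDiffOn_const).clm_apply hsnd).clm_apply hsnd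
  have hfirst : ContDiffOn ℝ 1 (fun z : E × E ↦ g.christoffelFirst e z.1 z.2 z.2)
      (e.target ×ˢ univ) :=
    ((((hd'.clm_apply hsnd).clm_apply hsnd).add ((hd'.clm_apply hsnd).clm_apply hsnd)).sub
      hfl).const_smul _
  exact hsnd.prodMk (hinv.clm_apply hfirst).neg

/-! ### Changes of charts -/

theorem contDiffAt_transition (he : e ∈ atlas E M) (he' : e' ∈ atlas E M) {x : E}
    (hx : x ∈ e.target) (hx' : e.symm x ∈ e'.source) : ContDiffAt ℝ ∞ (e' ∘ e.symm) x := by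
  rw [← contMDiffAt_iff_contDiffAt]
  have h1 := contMDiffOn_of_mem_maximalAtlas (I := 𝓘(ℝ, E)) (n := ∞)
    (IsManifold.subset_maximalAtlas he')
  exact (h1.contMDiffAt (e'.open_source.mem_nhds hx')).comp x
    ((contMDiffOn_symm_of_atlas he).contMDiffAt (e.open_target.mem_nhds hx))

theorem eventually_mem_target_source {x : E}
    (hx : x ∈ e.target) (hx' : e.symm x ∈ e'.source) :
    ∀ᶠ y in 𝓝 x, y ∈ e.target ∧ e.symm y ∈ e'.source :=
  Filter.Eventually.and (e.open_target.mem_nhds hx)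
    ((e.continuousAt_symm hx).eventually (e'.open_source.mem_nhds hx'))

theorem mfderiv_symm_eq_comp (he : e ∈ atlas E M) (he' : e' ∈ atlas E M) {x : E}
    (hx : x ∈ e.target) (hx' : e.symm x ∈ e'.source) (u : E) :
    (mfderiv 𝓘(ℝ, E) 𝓘(ℝ, E) e.symm x : E →L[ℝ] E) u =
     (mfderiv 𝓘(ℝ, E) 𝓘(ℝ, E) e'.symm ((e' ∘ e.symm) x) : E →L[ℝ] E)
       (fderiv ℝ (e' ∘ e.symm) x u) := by
  have h1 : e.symm =ᶠ[𝓝 x] e'.symm ∘ (e' ∘ e.symm) := by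
    filter_upwards [eventually_mem_target_source hx hx'] with y hy
    simp [e'.left_inv hy.2]
  have h2 : (e' ∘ e.symm) x ∈ e'.target := e'.map_source hx'
  have h3 := (mdifferentiable_of_atlas he').mdifferentiableAt_symm h2
  have h4 : MDifferentiableAt 𝓘(ℝ, E) 𝓘(ℝ, E) (e' ∘ e.symm) x :=
    ((contDiffAt_transition he he' hx hx').differentiableAt (by simp)).mdifferentiableAt
  have h5 : HasMFDerivAt 𝓘(ℝ, E) 𝓘(ℝ, E) e.symm x _ :=
    (h3.hasMFDerivAt.comp x h4.hasMFDerivAt).congr_of_eventuallyEq h1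
  have h6 := h5.mfderiv
  rw [mfderiv_eq_fderiv] at h6
  exact congrArg (fun L : E →L[ℝ] E ↦ L u) h6

theorem inChart_transition (g : LorentzMetric E M) (he : e ∈ atlas E M) (he' : e' ∈ atlas E M)
    {x : E} (hx : x ∈ e.target) (hx' : e.symm x ∈ e'.source) (u v : E) :
    g.inChart e x u v = g.inChart e' ((e' ∘ e.symm) x) (fderiv ℝ (e' ∘ e.symm) x u)
      (fderiv ℝ (e' ∘ e.symm) x v) := by
  have aux : ∀ (p q : M) (_ : p = q) (a b a' b' : E), a = a' → b = b' →
      (g.val p : E →L[ℝ] E →L[ℝ] ℝ) a b = (g.val q : E →L[ℝ] E →L[ℝ] ℝ) a' b' := by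
    rintro p _ rfl a b a' b' rfl rfl
    rfl
  rw [inChart_apply, inChart_apply]
  refine aux _ _ ?_ _ _ _ _ (mfderiv_symm_eq_comp he he' hx hx' u)
    (mfderiv_symm_eq_comp he he' hx hx' v)
  simp [e'.left_inv hx']

/-- Differentiate `inChart_transition` by the product rule. The two terms with second derivatives of
the transition map are the non-tensorial part, which must cancel in the geodesic equation. -/
theorem fderiv_inChart_transition [FiniteDimensional ℝ E] (g : LorentzMetric E M)
    (he : e ∈ atlas E M) (he' : e' ∈ atlas E M)
    {x : E} (hx : x ∈ e.target) (hx' : e.symm x ∈ e'.source) (d u v : E) :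
    fderiv ℝ (g.inChart e) x d u v =
      fderiv ℝ (g.inChart e') ((e' ∘ e.symm) x) (fderiv ℝ (e' ∘ e.symm) x d)
        (fderiv ℝ (e' ∘ e.symm) x u) (fderiv ℝ (e' ∘ e.symm) x v)
      + g.inChart e' ((e' ∘ e.symm) x) (fderiv ℝ (fderiv ℝ (e' ∘ e.symm)) x d u)
        (fderiv ℝ (e' ∘ e.symm) x v)
      + g.inChart e' ((e' ∘ e.symm) x) (fderiv ℝ (e' ∘ e.symm) x u)
        (fderiv ℝ (fderiv ℝ (e' ∘ e.symm)) x d v) := by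
  have hφ := contDiffAt_transition he he' hx hx'
  have htr : ∀ᶠ y in 𝓝 x, g.inChart e y u v = g.inChart e' ((e' ∘ e.symm) y)
      (fderiv ℝ (e' ∘ e.symm) y u) (fderiv ℝ (e' ∘ e.symm) y v) := by
    filter_upwards [eventually_mem_target_source hx hx'] with y hy
    exact inChart_transition g he he' hy.1 hy.2 u v
  have hφx : (e' ∘ e.symm) x ∈ e'.target := e'.map_source hx'
  generalize e' ∘ e.symm = φ at *
  have h1 : HasFDerivAt (g.inChart e) (fderiv ℝ (g.inChart e) x) x :=
    (((contDiffOn_inChart g he).contDiffAt (e.open_target.mem_nhds hx)).differentiableAt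
      (by simp)).hasFDerivAt
  have h2 : HasFDerivAt (g.inChart e') (fderiv ℝ (g.inChart e') (φ x)) (φ x) :=
    (((contDiffOn_inChart g he').contDiffAt (e'.open_target.mem_nhds hφx)).differentiableAt
      (by simp)).hasFDerivAt
  have h3 : HasFDerivAt φ (fderiv ℝ φ x) x := (hφ.differentiableAt (by simp)).hasFDerivAt
  have h4 : HasFDerivAt (fderiv ℝ φ) (fderiv ℝ (fderiv ℝ φ) x) x :=
    ((hφ.fderiv_right (m := ∞) (by simp)).differentiableAt (by simp)).hasFDerivAt
  have h5 := (h1.clm_apply (hasFDerivAt_const u x)).clm_apply (hasFDerivAt_const v x)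
  have h6 := ((h2.comp x h3).clm_apply (h4.clm_apply (hasFDerivAt_const u x))).clm_apply
    (h4.clm_apply (hasFDerivAt_const v x))
  have h8 := h5.unique (h6.congr_of_eventuallyEq htr)
  have h9 := congrArg (fun L : E →L[ℝ] ℝ ↦ L d) h8
  simp at h9
  rw [h9]
  ring

/-- The geodesic equation is invariant under changes of charts. -/
theorem geodesic_equation_transition [FiniteDimensional ℝ E] (g : LorentzMetric E M)
    (he : e ∈ atlas E M) (he' : e' ∈ atlas E M)
    {x : E} (hx : x ∈ e.target) (hx' : e.symm x ∈ e'.source) {a u : E}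
    (h : a + g.christoffel e x u u = 0) :
    (fderiv ℝ (fderiv ℝ (e' ∘ e.symm)) x u u + fderiv ℝ (e' ∘ e.symm) x a) +
      g.christoffel e' ((e' ∘ e.symm) x) (fderiv ℝ (e' ∘ e.symm) x u)
        (fderiv ℝ (e' ∘ e.symm) x u) = 0 := by
  have hφ := contDiffAt_transition he he' hx hx'
  have hφx : (e' ∘ e.symm) x ∈ e'.target := e'.map_source hx'
  rw [add_christoffel_eq_zero_iff g he hx] at h
  rw [add_christoffel_eq_zero_iff g he' hφx]
  have hback : x = (e ∘ e'.symm) ((e' ∘ e.symm) x) := by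
    simp [e'.left_inv hx', e.right_inv hx]
  -- It is enough to test the lowered equation on images of the differential, which is onto because
  -- the reverse transition map provides a right inverse.
  have hsurj : Function.Surjective (fderiv ℝ (e' ∘ e.symm) x) := by
    have hinv := contDiffAt_transition he' he hφx
      (by simpa [e'.left_inv hx'] using e.map_target hx)
    intro w
    refine ⟨fderiv ℝ (e ∘ e'.symm) ((e' ∘ e.symm) x) w, ?_⟩
    have h1 : ((e' ∘ e.symm) ∘ (e ∘ e'.symm)) =ᶠ[𝓝 ((e' ∘ e.symm) x)] id := by
      filter_upwards [eventually_mem_target_source (e := e') (e' := e) hφx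
        (by simpa [e'.left_inv hx'] using e.map_target hx)] with y hy
      simp [e.left_inv hy.2, e'.right_inv hy.1]
    have h2 := h1.fderiv_eq (𝕜 := ℝ)
    rw [fderiv_comp _ (by rw [← hback]; exact hφ.differentiableAt (by simp))
      (hinv.differentiableAt (by simp)), ← hback, fderiv_id] at h2
    exact congrArg (fun L : E →L[ℝ] E ↦ L w) h2
  intro w
  obtain ⟨w, rfl⟩ := hsurj w
  have hw := h w
  -- The mixed second-derivative term from `D_u g(u, w)` cancels the two equal terms from `½ D_w
  -- g(u, u)`, once the order of `u` and `w` is exchanged.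
  have hsymm : fderiv ℝ (fderiv ℝ (e' ∘ e.symm)) x u w
      = fderiv ℝ (fderiv ℝ (e' ∘ e.symm)) x w u :=
    (hφ.isSymmSndFDerivAt (by
      rw [minSmoothness_of_isRCLikeNormedField]; exact two_le_infty)) u w
  rw [inChart_transition g he he' hx hx', fderiv_inChart_transition g he he' hx hx',
    fderiv_inChart_transition g he he' hx hx', hsymm,
    g.inChart_symm _ _ (fderiv ℝ (fderiv ℝ (e' ∘ e.symm)) x w u)] at hw
  rw [map_add, add_apply]
  linarith

/-! ### Geodesics as integral curves on the tangent bundle -/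

/-- The velocity in `TM` of a curve defined near `t`. -/
def lift (γ : ℝ → M) (t : ℝ) : TangentBundle 𝓘(ℝ, E) M :=
  ⟨γ t, (mfderiv 𝓘(ℝ, ℝ) 𝓘(ℝ, E) γ t : ℝ →L[ℝ] TangentSpace 𝓘(ℝ, E) (γ t)) 1⟩

/-- The coordinates on `TM` induced by a chart of `M`. -/
def coords (e : OpenPartialHomeomorph M E) (z : TangentBundle 𝓘(ℝ, E) M) : E × E :=
  (e z.1, (mfderiv 𝓘(ℝ, E) 𝓘(ℝ, E) e z.1 : TangentSpace 𝓘(ℝ, E) z.1 →L[ℝ] E) z.2)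

/-- The inverse of `coords`. -/
def coordsSymm (e : OpenPartialHomeomorph M E) (y : E × E) : TangentBundle 𝓘(ℝ, E) M :=
  ⟨e.symm y.1, (mfderiv 𝓘(ℝ, E) 𝓘(ℝ, E) e.symm y.1 :
    E →L[ℝ] TangentSpace 𝓘(ℝ, E) (e.symm y.1)) y.2⟩

theorem continuousOn_coords (he : e ∈ atlas E M) :
    ContinuousOn (coords (M := M) e) {z | z.1 ∈ e.source} := by
  have h1 := (contMDiffOn_of_mem_maximalAtlas (I := 𝓘(ℝ, E)) (n := ∞)
    (IsManifold.subset_maximalAtlas he)).continuousOn_tangentMapWithin (by simp)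
      e.open_source.uniqueMDiffOn
  have h2 := (tangentBundleModelSpaceHomeomorph 𝓘(ℝ, E)).continuous.comp_continuousOn h1
  refine (h2.congr fun z hz ↦ ?_ : ContinuousOn (coords (M := M) e) _)
  simp only [coords, Function.comp, tangentMapWithin]
  rw [mfderivWithin_of_isOpen e.open_source hz]
  rfl

theorem continuousOn_coordsSymm (he : e ∈ atlas E M) :
    ContinuousOn (coordsSymm (M := M) e) (e.target ×ˢ univ) := by
  have h1 := (contMDiffOn_symm_of_atlas he).continuousOn_tangentMapWithin (by simp)
      e.open_target.uniqueMDiffOn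
  have h2 := h1.comp (s := e.target ×ˢ univ)
    (tangentBundleModelSpaceHomeomorph 𝓘(ℝ, E)).symm.continuous.continuousOn (fun z hz ↦ hz.1)
  refine (h2.congr fun z hz ↦ ?_ : ContinuousOn (coordsSymm (M := M) e) _)
  simp only [coordsSymm, Function.comp, tangentMapWithin]
  have : (mfderivWithin 𝓘(ℝ, E) 𝓘(ℝ, E) e.symm e.target z.1) =
    (mfderiv 𝓘(ℝ, E) 𝓘(ℝ, E) e.symm z.1) := mfderivWithin_of_isOpen e.open_target hz.1
  erw [this]
  rfl

theorem coordsSymm_coords (he : e ∈ atlas E M) {z : TangentBundle 𝓘(ℝ, E) M}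
    (hz : z.1 ∈ e.source) : coordsSymm e (coords e z) = z := by
  obtain ⟨p, v⟩ := z
  have h1 := (mdifferentiable_of_atlas he).symm_comp_deriv hz
  have h2 : e.symm (e p) = p := e.left_inv hz
  have aux : ∀ (q : M) (_ : q = p) (w : E), w = v →
    (⟨q, w⟩ : TangentBundle 𝓘(ℝ, E) M) = ⟨p, v⟩ := by
    rintro q rfl w rfl; rfl
  refine aux _ h2 _ ?_
  exact congrArg (fun L : E →L[ℝ] E ↦ L v) h1

theorem isOpen_proj_preimage {U : Set M} (hU : IsOpen U) :
    IsOpen {z : TangentBundle 𝓘(ℝ, E) M | z.1 ∈ U} :=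
  hU.preimage (FiberBundle.continuous_proj E (TangentSpace 𝓘(ℝ, E)))

theorem hasDerivAt_chart_comp (he : e ∈ atlas E M) {γ : ℝ → M} {t : ℝ}
    (hγ : MDifferentiableAt 𝓘(ℝ, ℝ) 𝓘(ℝ, E) γ t) (ht : γ t ∈ e.source) :
    HasDerivAt (fun s ↦ e (γ s)) (coords e (lift γ t)).2 t := by
  have h1 := (mdifferentiable_of_atlas he).mdifferentiableAt ht
  have h2 := h1.hasMFDerivAt.comp t hγ.hasMFDerivAt
  have h3 : ∀ L : ℝ →L[ℝ] E, HasFDerivAt (fun s ↦ e (γ s)) L t →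
      HasDerivAt (fun s ↦ e (γ s)) (L 1) t := fun L hL ↦ hL.hasDerivAt
  exact h3 _ h2.hasFDerivAt

theorem SolvesGeodesicEq.contMDiffAt {γ : ℝ → M} {U : Set ℝ} (h : g.SolvesGeodesicEq γ U)
    (hU : IsOpen U) {t : ℝ} (ht : t ∈ U) : ContMDiffAt 𝓘(ℝ, ℝ) 𝓘(ℝ, E) 2 γ t :=
  h.1.contMDiffAt (hU.mem_nhds ht)

theorem SolvesGeodesicEq.mdifferentiableAt {γ : ℝ → M} {U : Set ℝ} (h : g.SolvesGeodesicEq γ U)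
    (hU : IsOpen U) {t : ℝ} (ht : t ∈ U) : MDifferentiableAt 𝓘(ℝ, ℝ) 𝓘(ℝ, E) γ t :=
  (h.contMDiffAt hU ht).mdifferentiableAt (by simp)

theorem SolvesGeodesicEq.mono {γ : ℝ → M} {U V : Set ℝ} (h : g.SolvesGeodesicEq γ U)
    (hV : V ⊆ U) : g.SolvesGeodesicEq γ V :=
  ⟨h.1.mono hV, fun e he t ht ↦ h.2 e he t (hV ht)⟩

/-- The velocity of a geodesic is an integral curve of the geodesic field, in coordinates. -/
theorem SolvesGeodesicEq.hasDerivAt_coords {γ : ℝ → M} {U : Set ℝ} (h : g.SolvesGeodesicEq γ U)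
    (hU : IsOpen U) {t : ℝ} (ht : t ∈ U) (he : e ∈ atlas E M) (hte : γ t ∈ e.source) :
    HasDerivAt (fun s ↦ coords e (lift γ s)) (g.geodesicField e (coords e (lift γ t))) t := by
  have hev : ∀ᶠ s in 𝓝 t, s ∈ U ∧ γ s ∈ e.source :=
    Filter.Eventually.and (hU.mem_nhds ht)
      ((h.contMDiffAt hU ht).continuousAt.eventually (e.open_source.mem_nhds hte))
  have h1 : ∀ᶠ s in 𝓝 t, HasDerivAt (fun s ↦ e (γ s)) (coords e (lift γ s)).2 s := by
    filter_upwards [hev] with s hs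
    exact hasDerivAt_chart_comp he (h.mdifferentiableAt hU hs.1) hs.2
  have h2 : (deriv fun s ↦ e (γ s)) =ᶠ[𝓝 t] fun s ↦ (coords e (lift γ s)).2 := by
    filter_upwards [h1] with s hs using hs.deriv
  have h3 : ContDiffAt ℝ 2 (fun s ↦ e (γ s)) t := by
    rw [← contMDiffAt_iff_contDiffAt]
    exact (((contMDiffOn_of_mem_maximalAtlas (I := 𝓘(ℝ, E)) (n := ∞)
      (IsManifold.subset_maximalAtlas he)).contMDiffAt (e.open_source.mem_nhds hte)).of_le
      two_le_infty).comp t (h.contMDiffAt hU ht)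
  have h4 : HasDerivAt (deriv fun s ↦ e (γ s)) (deriv (deriv fun s ↦ e (γ s)) t) t := by
    have h5 : ContDiffAt ℝ 1 (deriv fun s ↦ e (γ s)) t := ContDiffAt.derivWithin h3 (by norm_num)
    exact (h5.differentiableAt (by simp)).hasDerivAt
  have h6 := h.2 e he t ht hte
  have h7 : HasDerivAt (fun s ↦ (coords e (lift γ s)).2)
      (-g.christoffel e (coords e (lift γ t)).1 (coords e (lift γ t)).2
        (coords e (lift γ t)).2) t := by
    rw [h2.eq_of_nhds] at h6
    have h8 := h4.congr_of_eventuallyEq h2.symm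
    rwa [eq_neg_of_add_eq_zero_left h6] at h8
  exact h1.self_of_nhds.prodMk h7

/-- An integral curve of the geodesic field in a chart is a geodesic. -/
theorem solvesGeodesicEq_of_hasDerivAt [FiniteDimensional ℝ E] (he : e ∈ atlas E M)
    {z : ℝ → E × E} {U : Set ℝ} (hU : IsOpen U) (hmem : ∀ t ∈ U, (z t).1 ∈ e.target)
    (hz : ∀ t ∈ U, HasDerivAt z (g.geodesicField e (z t)) t) :
    g.SolvesGeodesicEq (fun t ↦ e.symm (z t).1) U := by
  have hz1 : ∀ t ∈ U, HasDerivAt (fun s ↦ (z s).1) (z t).2 t := fun t ht ↦ (hz t ht).fst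
  have hz2 : ∀ t ∈ U, HasDerivAt (fun s ↦ (z s).2)
      (-g.christoffel e (z t).1 (z t).2 (z t).2) t := fun t ht ↦ (hz t ht).snd
  have hcont : ContinuousOn z U := fun t ht ↦ (hz t ht).continuousAt.continuousWithinAt
  have hfield : ContinuousOn (fun t ↦ g.geodesicField e (z t)) U :=
    (contDiffOn_geodesicField g he).continuousOn.comp hcont fun t ht ↦ ⟨hmem t ht, trivial⟩
  -- Bootstrap: `z' = f(z)` is continuous, so `z` is `C¹`; the position has derivative `z.2`, so it
  -- is `C²`.
  have hC1 : ContDiffOn ℝ 1 z U := by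
    have : ContDiffOn ℝ (0 + 1) z U := by
      rw [contDiffOn_succ_iff_deriv_of_isOpen hU]
      refine ⟨fun t ht ↦ (hz t ht).differentiableAt.differentiableWithinAt, by simp, ?_⟩
      rw [contDiffOn_zero]
      exact hfield.congr fun t ht ↦ (hz t ht).deriv
    simpa using this
  have hC2 : ContDiffOn ℝ 2 (fun s ↦ (z s).1) U := by
    have : ContDiffOn ℝ (1 + 1) (fun s ↦ (z s).1) U := by
      rw [contDiffOn_succ_iff_deriv_of_isOpen hU]
      refine ⟨fun t ht ↦ (hz1 t ht).differentiableAt.differentiableWithinAt, by simp, ?_⟩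
      exact hC1.snd.congr fun t ht ↦ (hz1 t ht).deriv
    norm_num at this
    exact this
  refine ⟨((contMDiffOn_symm_of_atlas he).of_le two_le_infty).comp hC2.contMDiffOn hmem, ?_⟩
  intro e' he' t ht hte'
  have hφ := contDiffAt_transition he he' (hmem t ht) hte'
  have hev : ∀ᶠ s in 𝓝 t, s ∈ U ∧ ContDiffAt ℝ ∞ (e' ∘ e.symm) (z s).1 := by
    have h1 := (hz1 t ht).continuousAt.eventually
      (eventually_mem_target_source (hmem t ht) hte')
    filter_upwards [hU.mem_nhds ht, h1] with s hs hs'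
    exact ⟨hs, contDiffAt_transition he he' hs'.1 hs'.2⟩
  have hd1 : ∀ᶠ s in 𝓝 t, HasDerivAt (fun s ↦ e' (e.symm (z s).1))
      (fderiv ℝ (e' ∘ e.symm) (z s).1 (z s).2) s := by
    filter_upwards [hev] with s hs
    exact (hs.2.differentiableAt (by simp)).hasFDerivAt.comp_hasDerivAt s (hz1 s hs.1)
  have hd2 : deriv (fun s ↦ e' (e.symm (z s).1)) =ᶠ[𝓝 t]
      fun s ↦ fderiv ℝ (e' ∘ e.symm) (z s).1 (z s).2 := by
    filter_upwards [hd1] with s hs using hs.deriv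
  have hd3 : HasDerivAt (fun s ↦ fderiv ℝ (e' ∘ e.symm) (z s).1)
      (fderiv ℝ (fderiv ℝ (e' ∘ e.symm)) (z t).1 (z t).2) t :=
    ((hφ.fderiv_right (m := ∞) (by simp)).differentiableAt
      (by simp)).hasFDerivAt.comp_hasDerivAt t (hz1 t ht)
  have hd4 := hd3.clm_apply (hz2 t ht)
  rw [hd2.deriv_eq, hd4.deriv, hd2.eq_of_nhds]
  exact geodesic_equation_transition g he he' (hmem t ht) hte' (by simp)

theorem lift_of_hasDerivAt [FiniteDimensional ℝ E] (he : e ∈ atlas E M)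
    {z : ℝ → E × E} {U : Set ℝ} (hU : IsOpen U) (hmem : ∀ t ∈ U, (z t).1 ∈ e.target)
    (hz : ∀ t ∈ U, HasDerivAt z (g.geodesicField e (z t)) t) {t : ℝ} (ht : t ∈ U) :
    lift (fun t ↦ e.symm (z t).1) t = coordsSymm (M := M) e (z t) := by
  have h0 := solvesGeodesicEq_of_hasDerivAt he hU hmem hz
  have hs : e.symm (z t).1 ∈ e.source := e.map_target (hmem t ht)
  have h1 := hasDerivAt_chart_comp he (h0.mdifferentiableAt hU ht) hs
  have h2 : HasDerivAt (fun s ↦ e (e.symm (z s).1)) (z t).2 t := by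
    have h3 : HasDerivAt (fun s ↦ (z s).1) (z t).2 t := (hz t ht).fst
    refine h3.congr_of_eventuallyEq ?_
    filter_upwards [hU.mem_nhds ht] with s hs'
    exact e.right_inv (hmem s hs')
  rw [← coordsSymm_coords he (z := lift (fun t ↦ e.symm (z t).1) t) hs]
  congr 1
  exact Prod.ext (e.right_inv (hmem t ht)) (h1.unique h2)

end LorentzMetric

/-! ### Local flow of an autonomous equation -/

/-- The local flow of a `C¹` vector field on an open set. -/
theorem exists_local_flow {F : Type*} [NormedAddCommGroup F] [NormedSpace ℝ F] [CompleteSpace F]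
    {f : F → F} {Ω : Set F} (hΩ : IsOpen Ω) (hf : ContDiffOn ℝ 1 f Ω) {z₀ : F} (hz₀ : z₀ ∈ Ω) :
    ∃ α : F × ℝ → F, ∃ N ∈ 𝓝 z₀, ∃ ε > 0, N ⊆ Ω ∧ ContinuousOn α (N ×ˢ Ioo (-ε) ε) ∧
      ∀ x ∈ N, α (x, 0) = x ∧ ∀ t ∈ Ioo (-ε) ε,
        α (x, t) ∈ Ω ∧ HasDerivAt (fun s ↦ α (x, s)) (f (α (x, t))) t := by
  obtain ⟨ε, hε, a, r, L, K, hr, hpl⟩ :=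
    IsPicardLindelof.of_contDiffAt_one (hf.contDiffAt (hΩ.mem_nhds hz₀))
  obtain ⟨α, h1, h2⟩ :=
    (hpl 0).exists_forall_mem_closedBall_eq_hasDerivWithinAt_continuousOn
  simp only [zero_sub, zero_add] at h1 h2
  have hnhds : Metric.closedBall z₀ r ×ˢ Icc (-ε) ε ∈ 𝓝 (z₀, (0 : ℝ)) :=
    prod_mem_nhds (Metric.closedBall_mem_nhds _ (by exact_mod_cast hr))
      (Icc_mem_nhds (by linarith) hε)
  have hα0 : α (z₀, 0) = z₀ := (h1 z₀ (Metric.mem_closedBall_self (by positivity))).1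
  -- Picard–Lindelöf does not itself keep the flow in `Ω`; continuity at `(z₀, 0)` does, after
  -- shrinking both the neighbourhood and the time.
  have hpre : ∀ᶠ y in 𝓝 (z₀, (0 : ℝ)), α y ∈ Ω :=
    (h2.continuousAt hnhds).eventually (by rw [hα0]; exact hΩ.mem_nhds hz₀)
  have hall := Filter.Eventually.and hnhds hpre
  rw [nhds_prod_eq, Filter.eventually_prod_iff] at hall
  obtain ⟨p, hp, q, hq, hpq⟩ := hall
  obtain ⟨δ, hδ, hδq⟩ := Metric.eventually_nhds_iff_ball.1 hq
  have hq' : ∀ t ∈ Ioo (-min δ ε) (min δ ε), q t := by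
    intro t ht
    apply hδq
    rw [Real.ball_eq_Ioo]
    exact ⟨by linarith [ht.1, min_le_left δ ε], by linarith [ht.2, min_le_left δ ε]⟩
  have h0 : (0 : ℝ) ∈ Ioo (-min δ ε) (min δ ε) := by
    have := lt_min hδ hε
    constructor <;> linarith
  refine ⟨α, {x | p x ∧ x ∈ Ω}, hp.and (hΩ.mem_nhds hz₀), min δ ε, lt_min hδ hε,
    fun x hx ↦ hx.2, ?_, ?_⟩
  · exact h2.mono fun y hy ↦ (hpq hy.1.1 (hq' _ hy.2)).1
  · intro x hx
    have hxb := (hpq hx.1 (hq' _ h0)).1.1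
    refine ⟨(h1 x hxb).1, fun t ht ↦ ⟨(hpq hx.1 (hq' _ ht)).2, ?_⟩⟩
    have hlt : t ∈ Ioo (-ε) ε :=
      ⟨by linarith [ht.1, min_le_right δ ε], by linarith [ht.2, min_le_right δ ε]⟩
    exact ((h1 x hxb).2 t (Ioo_subset_Icc_self hlt)).hasDerivAt (Icc_mem_nhds hlt.1 hlt.2)

namespace LorentzMetric

variable {E : Type*} [NormedAddCommGroup E] [NormedSpace ℝ E]
  {M : Type*} [TopologicalSpace M] [ChartedSpace E M] [IsManifold 𝓘(ℝ, E) ∞ M]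
  {g : LorentzMetric E M} {e e' : OpenPartialHomeomorph M E}

/-! ### Uniqueness of geodesics -/

theorem lift_congr {γ γ' : ℝ → M} {t : ℝ} (h : γ =ᶠ[𝓝 t] γ') :
    lift (E := E) γ t = lift γ' t := by
  have h1 : ∀ (q : M) (_ : q = γ' t) (w : E), w = (lift (E := E) γ' t).2 →
      (⟨q, w⟩ : TangentBundle 𝓘(ℝ, E) M) = lift γ' t := by
    rintro q rfl w rfl; rfl
  refine h1 _ h.eq_of_nhds _ ?_
  exact congrArg (fun L : ℝ →L[ℝ] E ↦ L 1) h.mfderiv_eq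

theorem SolvesGeodesicEq.continuousAt_lift {γ : ℝ → M} {U : Set ℝ} (h : g.SolvesGeodesicEq γ U)
    (hU : IsOpen U) {t : ℝ} (ht : t ∈ U) : ContinuousAt (lift (E := E) γ) t := by
  have he := chart_mem_atlas E (γ t)
  have hte := mem_chart_source E (γ t)
  have h1 := (h.hasDerivAt_coords hU ht he hte).continuousAt
  have hev := (h.contMDiffAt hU ht).continuousAt.eventually
    ((chartAt E (γ t)).open_source.mem_nhds hte)
  have h2 : ContinuousAt (fun s ↦ coordsSymm (chartAt E (γ t))
      (coords (chartAt E (γ t)) (lift (E := E) γ s))) t :=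
    ContinuousAt.comp (f := fun s ↦ coords (chartAt E (γ t)) (lift (E := E) γ s))
      ((continuousOn_coordsSymm he).continuousAt
      (((chartAt E (γ t)).open_target.prod isOpen_univ).mem_nhds
        ⟨(chartAt E (γ t)).map_source hte, trivial⟩)) h1
  refine h2.congr ?_
  filter_upwards [hev] with s hs using coordsSymm_coords he hs

/-- Local uniqueness of geodesics. -/
theorem eventuallyEq_of_lift_eq [FiniteDimensional ℝ E] {γ γ' : ℝ → M} {U : Set ℝ}
    (hU : IsOpen U) (h : g.SolvesGeodesicEq γ U) (h' : g.SolvesGeodesicEq γ' U) {t : ℝ}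
    (ht : t ∈ U) (heq : lift (E := E) γ t = lift γ' t) : γ =ᶠ[𝓝 t] γ' := by
  set e := chartAt E (γ t)
  have he : e ∈ atlas E M := chart_mem_atlas E (γ t)
  have hte : γ t ∈ e.source := mem_chart_source E (γ t)
  have hγ : γ t = γ' t := congrArg (fun z : TangentBundle 𝓘(ℝ, E) M ↦ z.1) heq
  have hte' : γ' t ∈ e.source := hγ ▸ hte
  have hev := (h.contMDiffAt hU ht).continuousAt.eventually (e.open_source.mem_nhds hte)
  have hev' := (h'.contMDiffAt hU ht).continuousAt.eventually (e.open_source.mem_nhds hte')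
  have hz : coords e (lift (E := E) γ t) ∈ e.target ×ˢ (univ : Set E) :=
    ⟨e.map_source hte, trivial⟩
  obtain ⟨K, s, hs, hK⟩ := ((contDiffOn_geodesicField g he).contDiffAt
    ((e.open_target.prod isOpen_univ).mem_nhds hz)).exists_lipschitzOnWith
  have hc := (h.hasDerivAt_coords hU ht he hte).continuousAt.eventually hs
  have hs' : s ∈ 𝓝 (coords e (lift (E := E) γ' t)) := heq ▸ hs
  have hc' := (h'.hasDerivAt_coords hU ht he hte').continuousAt.eventually hs'
  have key := ODE_solution_unique_of_eventually (v := fun _ ↦ g.geodesicField e)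
    (s := fun _ ↦ s) (K := K) (t₀ := t) (f := fun r ↦ coords e (lift (E := E) γ r))
    (g := fun r ↦ coords e (lift (E := E) γ' r)) (Filter.Eventually.of_forall fun _ ↦ hK)
    (by
      filter_upwards [hev, hU.mem_nhds ht, hc] with r h1 h2 h3
      exact ⟨h.hasDerivAt_coords hU h2 he h1, h3⟩)
    (by
      filter_upwards [hev', hU.mem_nhds ht, hc'] with r h1 h2 h3
      exact ⟨h'.hasDerivAt_coords hU h2 he h1, h3⟩)
    (by simp only [heq])
  filter_upwards [key, hev, hev'] with r h1 h2 h3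
  exact e.injOn h2 h3 (congrArg Prod.fst h1)

/-- Uniqueness of geodesics. -/
theorem lift_eqOn_of_lift_eq [FiniteDimensional ℝ E] [T2Space M] {γ γ' : ℝ → M} {J : Set ℝ}
    (hJ : IsOpen J) (hJ' : J.OrdConnected) (h : g.SolvesGeodesicEq γ J)
    (h' : g.SolvesGeodesicEq γ' J) {t₀ : ℝ} (ht₀ : t₀ ∈ J)
    (heq : lift (E := E) γ t₀ = lift γ' t₀) : EqOn (lift (E := E) γ) (lift γ') J := by
  have hsub : J ⊆ {t | t ∈ J ∧ lift (E := E) γ t = lift γ' t} := by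
    -- The set of times at which the velocities agree is open by local uniqueness and closed in the
    -- interval.
    refine hJ'.isPreconnected.subset_of_closure_inter_subset ?_ ⟨t₀, ht₀, ht₀, heq⟩ ?_
    · rw [isOpen_iff_mem_nhds]
      rintro t ⟨ht, heq⟩
      have := eventuallyEq_of_lift_eq hJ h h' ht heq
      filter_upwards [hJ.mem_nhds ht, this.eventuallyEq_nhds] with s hs hs'
      exact ⟨hs, lift_congr hs'⟩
    · rintro t ⟨ht, htJ⟩
      refine ⟨htJ, ?_⟩
      rw [mem_closure_iff_frequently] at ht
      -- The base points must agree first, by the Hausdorff property; only then is there a common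
      -- chart in which to pass to the limit in the velocities.
      have h1 : γ t = γ' t := by
        refine tendsto_nhds_unique_of_frequently_eq (h.contMDiffAt hJ htJ).continuousAt
          (h'.contMDiffAt hJ htJ).continuousAt (ht.mono fun s hs ↦ ?_)
        exact congrArg (fun z : TangentBundle 𝓘(ℝ, E) M ↦ z.1) hs.2
      have he := chart_mem_atlas E (γ t)
      have hte := mem_chart_source E (γ t)
      have hte' : γ' t ∈ (chartAt E (γ t)).source := h1 ▸ hte
      have h2 := tendsto_nhds_unique_of_frequently_eq
        (h.hasDerivAt_coords hJ htJ he hte).continuousAt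
        (h'.hasDerivAt_coords hJ htJ he hte').continuousAt
        (ht.mono fun s hs ↦ by simp only [hs.2])
      have h3 : coords (chartAt E (γ t)) (lift (E := E) γ t) =
        coords (chartAt E (γ t)) (lift (E := E) γ' t) := h2
      rw [← coordsSymm_coords he (z := lift γ t) hte, h3, coordsSymm_coords he hte']
  exact fun t ht ↦ (hsub ht).2

theorem eqOn_of_lift_eq [FiniteDimensional ℝ E] [T2Space M] {γ γ' : ℝ → M} {J : Set ℝ}
    (hJ : IsOpen J) (hJ' : J.OrdConnected) (h : g.SolvesGeodesicEq γ J)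
    (h' : g.SolvesGeodesicEq γ' J) {t₀ : ℝ} (ht₀ : t₀ ∈ J)
    (heq : lift (E := E) γ t₀ = lift γ' t₀) : EqOn γ γ' J := fun _ ht ↦
  congrArg (fun z : TangentBundle 𝓘(ℝ, E) M ↦ z.1)
    (lift_eqOn_of_lift_eq hJ hJ' h h' ht₀ heq ht)

/-! ### Gluing and affine reparametrization -/

/-- Being a geodesic is a local property. -/
theorem solvesGeodesicEq_of_locally {σ : ℝ → M} {U : Set ℝ}
    (h : ∀ t ∈ U, ∃ γ V, IsOpen V ∧ t ∈ V ∧ g.SolvesGeodesicEq γ V ∧ σ =ᶠ[𝓝 t] γ) :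
    g.SolvesGeodesicEq σ U := by
  refine ⟨fun t ht ↦ ?_, fun e he t ht hte ↦ ?_⟩
  · obtain ⟨γ, V, hV, htV, hγ, heq⟩ := h t ht
    exact ((hγ.contMDiffAt hV htV).congr_of_eventuallyEq heq).contMDiffWithinAt
  · obtain ⟨γ, V, hV, htV, hγ, heq⟩ := h t ht
    have h1 : (fun s ↦ e (σ s)) =ᶠ[𝓝 t] fun s ↦ e (γ s) := by
      filter_upwards [heq] with s hs
      rw [hs]
    have h2 := hγ.2 e he t htV (heq.eq_of_nhds ▸ hte)
    rwa [← h1.deriv.deriv_eq, ← h1.deriv_eq, ← heq.eq_of_nhds] at h2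

theorem SolvesGeodesicEq.exists_glue {γ γ' : ℝ → M} {J J' : Set ℝ} (hJ : IsOpen J)
    (hJ' : IsOpen J') (h : g.SolvesGeodesicEq γ J) (h' : g.SolvesGeodesicEq γ' J')
    (heq : EqOn γ γ' (J ∩ J')) :
    ∃ σ, g.SolvesGeodesicEq σ (J ∪ J') ∧ EqOn σ γ J ∧ EqOn σ γ' J' := by
  classical
  have h1 : EqOn (J.piecewise γ γ') γ J := piecewise_eqOn _ _ _
  have h2 : EqOn (J.piecewise γ γ') γ' J' := by
    intro t ht
    by_cases htJ : t ∈ J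
    · rw [h1 htJ, heq ⟨htJ, ht⟩]
    · exact piecewise_eq_of_notMem _ _ _ htJ
  refine ⟨_, solvesGeodesicEq_of_locally ?_, h1, h2⟩
  rintro t (ht | ht)
  · exact ⟨γ, J, hJ, ht, h, h1.eventuallyEq_of_mem (hJ.mem_nhds ht)⟩
  · exact ⟨γ', J', hJ', ht, h', h2.eventuallyEq_of_mem (hJ'.mem_nhds ht)⟩

theorem christoffel_smul (g : LorentzMetric E M) (e : OpenPartialHomeomorph M E) (x u : E)
    (a : ℝ) : g.christoffel e x (a • u) (a • u) = (a * a) • g.christoffel e x u u := by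
  have : g.christoffelFirst e x (a • u) (a • u) = (a * a) • g.christoffelFirst e x u u := by
    ext w
    simp only [christoffelFirst_apply, map_smul, smul_apply, smul_eq_mul]
    ring
  rw [christoffel, this, map_smul]
  rfl

/-- Affine reparametrizations of geodesics are geodesics. -/
theorem SolvesGeodesicEq.comp_affine {γ : ℝ → M} {U : Set ℝ} (h : g.SolvesGeodesicEq γ U)
    (a b : ℝ) : g.SolvesGeodesicEq (fun t ↦ γ (a * t + b)) {t | a * t + b ∈ U} := by
  refine ⟨?_, fun e he t ht hte ↦ ?_⟩
  · have h1 : ContDiff ℝ 2 (fun t : ℝ ↦ a * t + b) := by fun_prop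
    exact h.1.comp h1.contMDiff.contMDiffOn fun t ht ↦ ht
  · have key : ∀ f : ℝ → E, ∀ s, deriv (fun t ↦ f (a * t + b)) s = a • deriv f (a * s + b) := by
      intro f s
      have h1 := deriv_comp_mul_left a (fun t ↦ f (t + b)) s
      rw [deriv_comp_add_const] at h1
      exact h1
    have h1 : deriv (fun s ↦ e (γ (a * s + b))) =
        fun s ↦ a • deriv (fun s ↦ e (γ s)) (a * s + b) := by
      ext s
      exact key (fun s ↦ e (γ s)) s
    have h2 : deriv (fun s ↦ a • deriv (fun s ↦ e (γ s)) (a * s + b)) t =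
        (a * a) • deriv (deriv fun s ↦ e (γ s)) (a * t + b) := by
      rw [key (fun s ↦ a • deriv (fun s ↦ e (γ s)) s), mul_smul]
      congr 1
      exact deriv_fun_const_smul_field a _
    have h3 := h.2 e he _ ht hte
    rw [h1, h2, christoffel_smul, ← smul_add, h3, smul_zero]

theorem lift_comp_affine {γ : ℝ → M} {a b t : ℝ}
    (h : MDifferentiableAt 𝓘(ℝ, ℝ) 𝓘(ℝ, E) γ (a * t + b)) :
    lift (E := E) (fun t ↦ γ (a * t + b)) t =
      ⟨γ (a * t + b), a • (lift (E := E) γ (a * t + b)).2⟩ := by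
  have h1 : HasDerivAt (fun t : ℝ ↦ a * t + b) a t := by
    simpa using ((hasDerivAt_id t).const_mul a).add_const b
  have h2 := h.hasMFDerivAt.comp t h1.hasFDerivAt.hasMFDerivAt
  have h3 : ∀ L : ℝ →L[ℝ] E, L a = a • L 1 := fun L ↦ by
    rw [← L.map_smul, smul_eq_mul, mul_one]
  have h4 : ∀ w w' : E, w = w' → (⟨γ (a * t + b), w⟩ : TangentBundle 𝓘(ℝ, E) M) =
    ⟨γ (a * t + b), w'⟩ := fun w w' h ↦ h ▸ rfl
  refine h4 _ _ ?_
  have h5 := congrArg (fun L : ℝ →L[ℝ] E ↦ L 1) h2.mfderiv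
  refine h5.trans (Eq.trans ?_ (h3 _))
  change (mfderiv 𝓘(ℝ, ℝ) 𝓘(ℝ, E) γ (a * t + b) : ℝ →L[ℝ] E) _ = _
  congr 1
  exact one_mul a

/-! ### Continuous dependence on the initial velocity -/

/-- The local geodesic flow. -/
theorem exists_local_geodesic_flow [FiniteDimensional ℝ E] (g : LorentzMetric E M)
    (z₀ : TangentBundle 𝓘(ℝ, E) M) :
    ∃ φ : TangentBundle 𝓘(ℝ, E) M → ℝ → M, ∃ N ∈ 𝓝 z₀, ∃ ε > 0,
      (∀ z ∈ N, g.SolvesGeodesicEq (φ z) (Ioo (-ε) ε) ∧ lift (φ z) 0 = z) ∧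
      ∀ t ∈ Ioo (-ε) ε, ContinuousOn (fun z ↦ lift (E := E) (φ z) t) N := by
  have := FiniteDimensional.complete ℝ E
  set e := chartAt E z₀.1
  have he : e ∈ atlas E M := chart_mem_atlas E z₀.1
  have hz₀ : z₀.1 ∈ e.source := mem_chart_source E z₀.1
  have hopen : IsOpen {z : TangentBundle 𝓘(ℝ, E) M | z.1 ∈ e.source} :=
    isOpen_proj_preimage e.open_source
  have hmem : coords e z₀ ∈ e.target ×ˢ (univ : Set E) := ⟨e.map_source hz₀, trivial⟩
  obtain ⟨α, N, hN, ε, hε, -, hcont, hα⟩ := exists_local_flow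
    (e.open_target.prod isOpen_univ) (contDiffOn_geodesicField g he) hmem
  have h0 : (0 : ℝ) ∈ Ioo (-ε) ε := ⟨by linarith, hε⟩
  have hlift : ∀ z : TangentBundle 𝓘(ℝ, E) M, coords e z ∈ N → ∀ t ∈ Ioo (-ε) ε,
      lift (fun t ↦ e.symm (α (coords e z, t)).1) t = coordsSymm (M := M) e (α (coords e z, t)) :=
    fun z hz t ht ↦ lift_of_hasDerivAt (z := fun t ↦ α (coords e z, t)) he isOpen_Ioo
      (fun s hs ↦ ((hα _ hz).2 s hs).1.1) (fun s hs ↦ ((hα _ hz).2 s hs).2) ht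
  refine ⟨fun z t ↦ e.symm (α (coords e z, t)).1, {z | z.1 ∈ e.source ∧ coords e z ∈ N},
    Filter.Eventually.and (hopen.mem_nhds hz₀)
      (((continuousOn_coords he).continuousAt (hopen.mem_nhds hz₀)).eventually hN),
    ε, hε, fun z hz ↦ ⟨?_, ?_⟩, fun t ht ↦ ?_⟩
  · exact solvesGeodesicEq_of_hasDerivAt (z := fun t ↦ α (coords e z, t)) he isOpen_Ioo
      (fun s hs ↦ ((hα _ hz.2).2 s hs).1.1) fun s hs ↦ ((hα _ hz.2).2 s hs).2
  · rw [hlift z hz.2 0 h0, (hα _ hz.2).1, coordsSymm_coords he hz.1]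
  · have h1 : ContinuousOn (fun z : TangentBundle 𝓘(ℝ, E) M ↦ (coords e z, t))
        {z | z.1 ∈ e.source ∧ coords e z ∈ N} :=
      ((continuousOn_coords he).mono fun z hz ↦ hz.1).prodMk continuousOn_const
    have h2 := (continuousOn_coordsSymm he).comp (hcont.comp h1 fun z hz ↦ ⟨hz.2, ht⟩)
      fun z hz ↦ ((hα _ hz.2).2 t ht).1
    exact h2.congr fun z hz ↦ hlift z hz.2 t ht

/-- Continuous dependence of geodesics on their initial velocity: the geodesics whose velocity at
time `s` is close to that of `γ` are defined up to time `t`, with velocity close to that of `γ`. -/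
def DependsContinuously (g : LorentzMetric E M) (γ : ℝ → M) (s t : ℝ) : Prop :=
  ∀ N ∈ 𝓝 (lift (E := E) γ t), ∀ᶠ z in 𝓝 (lift (E := E) γ s), ∃ (σ : ℝ → M) (J : Set ℝ),
    IsOpen J ∧ J.OrdConnected ∧ s ∈ J ∧ t ∈ J ∧ g.SolvesGeodesicEq σ J ∧ lift σ s = z ∧
      lift σ t ∈ N

theorem DependsContinuously.trans [FiniteDimensional ℝ E] [T2Space M] {γ : ℝ → M} {r s t : ℝ}
    (h : g.DependsContinuously γ r s) (h' : g.DependsContinuously γ s t) :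
    g.DependsContinuously γ r t := by
  intro N hN
  filter_upwards [h _ (h' N hN)] with z hz
  obtain ⟨σ, J, hJ, hJc, hrJ, hsJ, hσ, hσr, σ', J', hJ', hJc', hsJ', htJ', hσ', hσs', hσt'⟩ := hz
  obtain ⟨τ, hτ, hτJ, hτJ'⟩ := hσ.exists_glue hJ hJ' hσ'
    (eqOn_of_lift_eq (hJ.inter hJ') (hJc.inter hJc') (hσ.mono inter_subset_left)
      (hσ'.mono inter_subset_right) ⟨hsJ, hsJ'⟩ hσs'.symm)
  refine ⟨τ, J ∪ J', hJ.union hJ', ?_, Or.inl hrJ, Or.inr htJ', hτ, ?_, ?_⟩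
  · exact (hJc.isPreconnected.union s hsJ hsJ' hJc'.isPreconnected).ordConnected
  · rw [lift_congr (hτJ.eventuallyEq_of_mem (hJ.mem_nhds hrJ)), hσr]
  · rwa [lift_congr (hτJ'.eventuallyEq_of_mem (hJ'.mem_nhds htJ'))]

/-- The relation is transitive, so on a connected set of times it need only be checked between
nearby times, in both orders. There it is the continuity of the local flow, started at the earlier
or later of the two times. -/
theorem SolvesGeodesicEq.dependsContinuously [FiniteDimensional ℝ E] [T2Space M] {γ : ℝ → M}
    {J : Set ℝ} (h : g.SolvesGeodesicEq γ J) (hJ : IsOpen J) (hJc : J.OrdConnected) {s t : ℝ}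
    (hs : s ∈ J) (ht : t ∈ J) : g.DependsContinuously γ s t := by
  refine hJc.isPreconnected.induction₂' (g.DependsContinuously γ) ?_
    (fun _ _ _ _ _ _ ↦ DependsContinuously.trans) hs ht
  intro τ hτ
  obtain ⟨φ, N, hN, ε, hε, hφ, hcont⟩ := exists_local_geodesic_flow g (lift γ τ)
  have key : ∀ a ∈ J, ∀ b ∈ J, b - a ∈ Ioo (-ε) ε → N ∈ 𝓝 (lift (E := E) γ a) →
      g.DependsContinuously γ a b := by
    intro a ha b hb hab hNa N' hN'
    have hshift : ∀ z ∈ N, g.SolvesGeodesicEq (fun r ↦ φ z (1 * r + (-a))) (Ioo (a - ε) (a + ε)) ∧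
        ∀ r ∈ Ioo (a - ε) (a + ε), lift (E := E) (fun r ↦ φ z (1 * r + (-a))) r =
          lift (φ z) (r - a) := by
      intro z hz
      refine ⟨((hφ z hz).1.comp_affine 1 (-a)).mono fun r hr ↦ ?_, fun r hr ↦ ?_⟩
      · simp only [mem_ofPred_eq, mem_Ioo] at hr ⊢
        constructor <;> linarith
      · have heq : 1 * r + -a = r - a := by ring
        rw [lift_comp_affine, heq]
        · rw [one_smul]
          rfl
        · refine (hφ z hz).1.mdifferentiableAt isOpen_Ioo ?_
          simp only [mem_Ioo] at hr ⊢
          constructor <;> linarith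
    have haI : a ∈ Ioo (a - ε) (a + ε) := ⟨by linarith, by linarith⟩
    have hbI : b ∈ Ioo (a - ε) (a + ε) := ⟨by linarith [hab.1], by linarith [hab.2]⟩
    have hNa' : lift γ a ∈ N := mem_of_mem_nhds hNa
    -- By uniqueness, the flow line started at the velocity of `γ` at time `a` is `γ` itself,
    -- shifted in time.
    have hval : lift (φ (lift γ a)) (b - a) = lift (E := E) γ b := by
      rw [← (hshift _ hNa').2 b hbI]
      refine lift_eqOn_of_lift_eq (hJ.inter isOpen_Ioo) (hJc.inter ordConnected_Ioo)
        ((hshift _ hNa').1.mono inter_subset_right) (h.mono inter_subset_left) ⟨ha, haI⟩ ?_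
        ⟨hb, hbI⟩
      rw [(hshift _ hNa').2 a haI, sub_self, (hφ _ hNa').2]
    have hc := ((hcont _ hab).continuousAt hNa).eventually (p := (· ∈ N'))
      (by beta_reduce; rw [hval]; exact hN')
    filter_upwards [hc, hNa] with z hz hzN
    refine ⟨fun r ↦ φ z (1 * r + (-a)), _, isOpen_Ioo, ordConnected_Ioo, haI, hbI,
      (hshift z hzN).1, ?_, ?_⟩
    · rw [(hshift z hzN).2 a haI, sub_self, (hφ z hzN).2]
    · rwa [(hshift z hzN).2 b hbI]
  have h1 : ∀ᶠ a in 𝓝 τ, N ∈ 𝓝 (lift (E := E) γ a) :=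
    (h.continuousAt_lift hJ hτ).eventually (eventually_mem_nhds_iff.2 hN)
  have h2 : ∀ᶠ a in 𝓝 τ, a ∈ Ioo (τ - ε) (τ + ε) := Ioo_mem_nhds (by linarith) (by linarith)
  filter_upwards [mem_nhdsWithin_of_mem_nhds h1, mem_nhdsWithin_of_mem_nhds h2,
    self_mem_nhdsWithin] with a ha1 ha2 ha3
  simp only [mem_Ioo] at ha2
  exact ⟨key τ hτ a ha3 ⟨by linarith [ha2.1], by linarith [ha2.2]⟩ hN,
    key a ha3 τ hτ ⟨by linarith [ha2.1], by linarith [ha2.2]⟩ ha1⟩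

/-! ### Conservation of the causal character -/

/-- The energy `g(v, v)`, as a function on the tangent bundle. -/
def energy (g : LorentzMetric E M) (z : TangentBundle 𝓘(ℝ, E) M) : ℝ := g.val z.1 z.2 z.2

theorem energy_eq_inChart (g : LorentzMetric E M) (he : e ∈ atlas E M)
    {z : TangentBundle 𝓘(ℝ, E) M} (hz : z.1 ∈ e.source) :
    g.energy z = g.inChart e (coords e z).1 (coords e z).2 (coords e z).2 := by
  conv_lhs => rw [← coordsSymm_coords he hz]
  rw [inChart_apply]
  rfl

/-- The acceleration enters both slots and contributes `-2(D_u g(u, u) - ½ D_u g(u, u))`, which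
cancels the derivative `D_u g(u, u)` of the metric. -/
theorem hasDerivAt_inChart_integralCurve [FiniteDimensional ℝ E] (g : LorentzMetric E M)
    (he : e ∈ atlas E M) {z : ℝ → E × E} {t : ℝ} (hx : (z t).1 ∈ e.target)
    (hz : HasDerivAt z (g.geodesicField e (z t)) t) :
    HasDerivAt (fun s ↦ g.inChart e (z s).1 (z s).2 (z s).2) 0 t := by
  have hz1 : HasDerivAt (fun s ↦ (z s).1) (z t).2 t := hz.fst
  have hz2 : HasDerivAt (fun s ↦ (z s).2) (-g.christoffel e (z t).1 (z t).2 (z t).2) t := hz.snd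
  have hg : HasFDerivAt (g.inChart e) (fderiv ℝ (g.inChart e) (z t).1) (z t).1 :=
    (((contDiffOn_inChart g he).contDiffAt (e.open_target.mem_nhds hx)).differentiableAt
      (by simp)).hasFDerivAt
  have hg' : HasDerivAt (fun s ↦ g.inChart e (z s).1) (fderiv ℝ (g.inChart e) (z t).1 (z t).2) t :=
    HasFDerivAt.comp_hasDerivAt (F := E) (E := E →L[ℝ] E →L[ℝ] ℝ) (l := g.inChart e)
      (f := fun s ↦ (z s).1) t hg hz1
  have h3 := (hg'.clm_apply hz2).clm_apply hz2
  refine h3.congr_deriv ?_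
  simp only [add_apply, map_neg, neg_apply]
  rw [g.inChart_symm e _ (z t).2 (g.christoffel e _ _ _), inChart_christoffel g he hx,
    christoffelFirst_apply]
  ring

theorem SolvesGeodesicEq.hasDerivAt_energy [FiniteDimensional ℝ E] {γ : ℝ → M} {U : Set ℝ}
    (h : g.SolvesGeodesicEq γ U) (hU : IsOpen U) {t : ℝ} (ht : t ∈ U) :
    HasDerivAt (fun s ↦ g.energy (lift γ s)) 0 t := by
  have he := chart_mem_atlas E (γ t)
  have hte := mem_chart_source E (γ t)
  have hev := (h.contMDiffAt hU ht).continuousAt.eventually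
    ((chartAt E (γ t)).open_source.mem_nhds hte)
  refine (hasDerivAt_inChart_integralCurve g he ((chartAt E (γ t)).map_source hte)
    (h.hasDerivAt_coords hU ht he hte)).congr_of_eventuallyEq ?_
  filter_upwards [hev] with s hs using energy_eq_inChart g he hs

theorem SolvesGeodesicEq.energy_eq [FiniteDimensional ℝ E] {γ : ℝ → M} {J : Set ℝ}
    (h : g.SolvesGeodesicEq γ J) (hJ : IsOpen J) (hJc : J.OrdConnected) {s t : ℝ}
    (hs : s ∈ J) (ht : t ∈ J) : g.energy (lift γ s) = g.energy (lift γ t) :=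
  hJ.is_const_of_deriv_eq_zero hJc.isPreconnected
    (fun _ hr ↦ (h.hasDerivAt_energy hJ hr).differentiableAt.differentiableWithinAt)
    (fun _ hr ↦ (h.hasDerivAt_energy hJ hr).deriv) hs ht

theorem SolvesGeodesicEq.velocity_ne_zero [FiniteDimensional ℝ E] [T2Space M] {γ : ℝ → M}
    {J : Set ℝ} (h : g.SolvesGeodesicEq γ J) (hJ : IsOpen J) (hJc : J.OrdConnected) {s t : ℝ}
    (hs : s ∈ J) (ht : t ∈ J) (h0 : (lift (E := E) γ s).2 ≠ 0) : (lift (E := E) γ t).2 ≠ 0 := by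
  intro hzero
  -- Affine reparametrization with slope 0 gives the constant geodesic. If the velocity vanished at
  -- `t`, uniqueness would make `γ` equal to it.
  have hconst : ∀ r, lift (E := E) (fun u ↦ γ (0 * u + t)) r = ⟨γ (0 * r + t), 0⟩ := by
    intro r
    rw [lift_comp_affine (h.mdifferentiableAt hJ (by simpa using ht)), zero_smul]
    rfl
  have hsol : g.SolvesGeodesicEq (fun u ↦ γ (0 * u + t)) J :=
    (h.comp_affine 0 t).mono fun r _ ↦ by simpa using ht
  have hteq : lift (E := E) γ t = lift (fun u ↦ γ (0 * u + t)) t := by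
    have h1 : ∀ w : TangentSpace 𝓘(ℝ, E) (γ t), w = 0 →
      (⟨γ t, w⟩ : TangentBundle 𝓘(ℝ, E) M) = ⟨γ t, 0⟩ := by rintro w rfl; rfl
    have h2 : ∀ q : M, γ t = q → (⟨γ t, 0⟩ : TangentBundle 𝓘(ℝ, E) M) = ⟨q, 0⟩ := by
      rintro q rfl; rfl
    rw [hconst]
    exact (h1 _ hzero).trans (h2 _ (by simp))
  have h3 := lift_eqOn_of_lift_eq hJ hJc h hsol ht hteq hs
  rw [hconst] at h3
  apply h0
  rw [h3]

/-! ### Geodesics on intervals and the exponential map -/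

/-- A geodesic on an interval is the restriction of a geodesic on an open interval. -/
theorem IsGeodesicOn.exists_ordConnected {γ : ℝ → M} {s : Set ℝ} (h : g.IsGeodesicOn γ s)
    (hs : s.OrdConnected) (hne : s.Nonempty) :
    ∃ (J : Set ℝ) (σ : ℝ → M), IsOpen J ∧ J.OrdConnected ∧ s ⊆ J ∧ EqOn γ σ s ∧
      g.SolvesGeodesicEq σ J := by
  obtain ⟨U, σ, hU, hsU, heq, hσ⟩ := h
  obtain ⟨t₀, ht₀⟩ := hne
  exact ⟨connectedComponentIn U t₀, σ, hU.connectedComponentIn,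
    isPreconnected_iff_ordConnected.1 isPreconnected_connectedComponentIn,
    hs.isPreconnected.subset_connectedComponentIn ht₀ hsU, heq,
    hσ.mono (connectedComponentIn_subset U t₀)⟩

theorem uniqueDiffOn_of_ordConnected {s : Set ℝ} (hs : s.OrdConnected) (hnt : s.Nontrivial) :
    UniqueDiffOn ℝ s := by
  refine uniqueDiffOn_convex hs.convex ?_
  obtain ⟨a, ha, b, hb, hab⟩ := hnt.exists_lt
  exact ⟨(a + b) / 2, interior_maximal (Ioo_subset_Icc_self.trans (hs.out ha hb)) isOpen_Ioo
    ⟨by linarith, by linarith⟩⟩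

/-- Derivatives within a nondegenerate interval are unique even at its endpoints, so the velocity
can be read off any geodesic extending the curve to a neighbourhood. -/
theorem velocity_eq_lift {γ σ : ℝ → M} {s : Set ℝ} (hs : s.OrdConnected) (hnt : s.Nontrivial)
    (heq : EqOn γ σ s) {t : ℝ} (ht : t ∈ s) (hσ : MDifferentiableAt 𝓘(ℝ, ℝ) 𝓘(ℝ, E) σ t) :
    velocity (E := E) γ s t = lift σ t := by
  have hu : UniqueMDiffWithinAt 𝓘(ℝ, ℝ) s t :=
    (uniqueDiffOn_of_ordConnected hs hnt t ht).uniqueMDiffWithinAt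
  have h1 := (hσ.hasMFDerivAt.hasMFDerivWithinAt (s := s)).congr_of_eventuallyEq
    (heq.eventuallyEq_of_mem self_mem_nhdsWithin) (heq ht)
  have h2 := h1.mfderivWithin hu
  have h3 : ∀ (q : M) (_ : q = σ t) (w : E), w = (lift (E := E) σ t).2 →
      (⟨q, w⟩ : TangentBundle 𝓘(ℝ, E) M) = lift σ t := by
    rintro q rfl w rfl; rfl
  exact h3 _ (heq ht) _ (congrArg (fun L : ℝ →L[ℝ] E ↦ L 1) h2)

theorem Geodesic.exists_open (γ : g.Geodesic) :
    ∃ (J : Set ℝ) (σ : ℝ → M), IsOpen J ∧ J.OrdConnected ∧ γ.dom ⊆ J ∧ EqOn γ.toFun σ γ.dom ∧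
      g.SolvesGeodesicEq σ J ∧ ∀ t ∈ γ.dom, velocity (E := E) γ.toFun γ.dom t = lift σ t := by
  obtain ⟨J, σ, hJ, hJc, hsub, heq, hσ⟩ :=
    γ.isGeodesicOn.exists_ordConnected γ.ordConnected γ.nontrivial.nonempty
  exact ⟨J, σ, hJ, hJc, hsub, heq, hσ, fun t ht ↦
    velocity_eq_lift γ.ordConnected γ.nontrivial heq ht (hσ.mdifferentiableAt hJ (hsub ht))⟩

theorem nontrivial_Icc_zero_one : (Icc (0 : ℝ) 1).Nontrivial :=
  ⟨0, by simp, 1, by simp, by norm_num⟩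

theorem isExpGeodesic_of_solves {p : M} {v : TangentSpace 𝓘(ℝ, E) p} {σ : ℝ → M} {J : Set ℝ}
    (hJ : IsOpen J) (hsub : Icc 0 1 ⊆ J) (hσ : g.SolvesGeodesicEq σ J)
    (h0 : lift σ 0 = (⟨p, v⟩ : TangentBundle 𝓘(ℝ, E) M)) : g.IsExpGeodesic p v σ := by
  refine ⟨⟨J, σ, hJ, hsub, fun _ _ ↦ rfl, hσ⟩, ?_⟩
  rw [velocity_eq_lift ordConnected_Icc nontrivial_Icc_zero_one (fun _ _ ↦ rfl)
    (by simp) (hσ.mdifferentiableAt hJ (hsub (by simp))), h0]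

theorem IsExpGeodesic.exists_solves {p : M} {v : TangentSpace 𝓘(ℝ, E) p} {γ : ℝ → M}
    (h : g.IsExpGeodesic p v γ) : ∃ (J : Set ℝ) (σ : ℝ → M), IsOpen J ∧ J.OrdConnected ∧
      Icc 0 1 ⊆ J ∧ γ 1 = σ 1 ∧ g.SolvesGeodesicEq σ J ∧
      lift σ 0 = (⟨p, v⟩ : TangentBundle 𝓘(ℝ, E) M) := by
  obtain ⟨J, σ, hJ, hJc, hsub, heq, hσ⟩ :=
    h.1.exists_ordConnected ordConnected_Icc nontrivial_Icc_zero_one.nonempty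
  refine ⟨J, σ, hJ, hJc, hsub, heq (by simp), hσ, ?_⟩
  rw [← h.2, velocity_eq_lift ordConnected_Icc nontrivial_Icc_zero_one heq
    (by simp) (hσ.mdifferentiableAt hJ (hsub (by simp)))]

theorem exp_eq_of_isExpGeodesic [FiniteDimensional ℝ E] [T2Space M] {p : M}
    {v : TangentSpace 𝓘(ℝ, E) p} {γ : ℝ → M} (h : g.IsExpGeodesic p v γ) : g.exp p v = γ 1 := by
  have hex : ∃ γ : ℝ → M, g.IsExpGeodesic p v γ := ⟨γ, h⟩
  rw [exp, dif_pos hex]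
  obtain ⟨J, σ, hJ, hJc, hsub, heq, hσ, h0⟩ := h.exists_solves
  obtain ⟨J', σ', hJ', hJc', hsub', heq', hσ', h0'⟩ := hex.choose_spec.exists_solves
  rw [heq, heq']
  exact (eqOn_of_lift_eq (hJ.inter hJ') (hJc.inter hJc') (hσ'.mono inter_subset_right)
    (hσ.mono inter_subset_left) (t₀ := 0) ⟨hsub (by simp), hsub' (by simp)⟩ (h0'.trans h0.symm))
    ⟨hsub (by simp), hsub' (by simp)⟩

/-- Geodesics are given by the exponential map. -/
theorem SolvesGeodesicEq.eq_exp [FiniteDimensional ℝ E] [T2Space M] {σ : ℝ → M} {J : Set ℝ}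
    (hJ : IsOpen J) (hJc : J.OrdConnected) (hσ : g.SolvesGeodesicEq σ J) {p : M}
    {v : TangentSpace 𝓘(ℝ, E) p} {s t : ℝ} (hs : s ∈ J) (ht : t ∈ J)
    (h0 : lift σ s = (⟨p, v⟩ : TangentBundle 𝓘(ℝ, E) M)) :
    (t - s) • v ∈ g.expDomain p ∧ g.exp p ((t - s) • v) = σ t := by
  have hpt : σ s = p := congrArg (fun z : TangentBundle 𝓘(ℝ, E) M ↦ z.1) h0
  have key : g.IsExpGeodesic p ((t - s) • v) (fun r ↦ σ ((t - s) * r + s)) := by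
    refine isExpGeodesic_of_solves (hJ.preimage (by fun_prop : Continuous fun r : ℝ ↦
      (t - s) * r + s)) ?_ (hσ.comp_affine (t - s) s) ?_
    · intro r hr
      have h1 := hJc.convex hs ht (sub_nonneg.2 hr.2) hr.1 (by ring)
      have h2 : (t - s) * r + s = (1 - r) • s + r • t := by simp only [smul_eq_mul]; ring
      rw [mem_preimage, h2]
      exact h1
    · rw [lift_comp_affine (hσ.mdifferentiableAt hJ (by simpa using hs))]
      have h2 : ∀ r : ℝ, r = s → (⟨σ r, (t - s) • (lift (E := E) σ r).2⟩ :
          TangentBundle 𝓘(ℝ, E) M) = ⟨p, (t - s) • v⟩ := by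
        rintro r rfl
        subst hpt
        have h3 : ∀ z : TangentBundle 𝓘(ℝ, E) M, z = ⟨σ r, v⟩ →
          (⟨z.1, (t - r) • z.2⟩ : TangentBundle 𝓘(ℝ, E) M) = ⟨σ r, (t - r) • v⟩ := by
          rintro z rfl; rfl
        exact h3 _ h0
      exact h2 _ (by simp)
  refine ⟨⟨_, key⟩, ?_⟩
  rw [exp_eq_of_isExpGeodesic key]
  simp

theorem exists_solves_zero [FiniteDimensional ℝ E] (g : LorentzMetric E M)
    (z : TangentBundle 𝓘(ℝ, E) M) : ∃ (J : Set ℝ) (σ : ℝ → M), IsOpen J ∧ J.OrdConnected ∧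
      0 ∈ J ∧ g.SolvesGeodesicEq σ J ∧ lift σ 0 = z := by
  obtain ⟨φ, N, hN, ε, hε, hφ, -⟩ := exists_local_geodesic_flow g z
  have h := hφ z (mem_of_mem_nhds hN)
  exact ⟨Ioo (-ε) ε, φ z, isOpen_Ioo, ordConnected_Ioo, ⟨by linarith, hε⟩, h.1, h.2⟩

theorem exists_solves_of_smul_mem_expDomain [FiniteDimensional ℝ E] {p : M}
    {v : TangentSpace 𝓘(ℝ, E) p} {t : ℝ} (h : t • v ∈ g.expDomain p) :
    ∃ (J : Set ℝ) (σ : ℝ → M), IsOpen J ∧ J.OrdConnected ∧ 0 ∈ J ∧ t ∈ J ∧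
      g.SolvesGeodesicEq σ J ∧ lift σ 0 = (⟨p, v⟩ : TangentBundle 𝓘(ℝ, E) M) := by
  -- For `t = 0` the hypothesis says nothing about `v`, and short-time existence is used; otherwise
  -- the geodesic of `t • v` is rescaled by `t⁻¹`.
  rcases eq_or_ne t 0 with rfl | ht
  · obtain ⟨J, σ, hJ, hJc, h0, hσ, hl⟩ := exists_solves_zero g ⟨p, v⟩
    exact ⟨J, σ, hJ, hJc, h0, h0, hσ, hl⟩
  obtain ⟨γ, hγ⟩ := h
  obtain ⟨J, σ, hJ, hJc, hsub, -, hσ, h0⟩ := hγ.exists_solves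
  have hcont : Continuous fun r : ℝ ↦ t⁻¹ * r + 0 := by fun_prop
  refine ⟨{r | t⁻¹ * r + 0 ∈ J}, fun r ↦ σ (t⁻¹ * r + 0), hJ.preimage hcont, ?_, ?_, ?_,
    hσ.comp_affine t⁻¹ 0, ?_⟩
  · refine Convex.ordConnected fun x hx y hy a b ha hb hab ↦ ?_
    have h1 := hJc.convex hx hy ha hb hab
    have h2 : t⁻¹ * (a • x + b • y) + 0 = a • (t⁻¹ * x + 0) + b • (t⁻¹ * y + 0) := by
      simp only [smul_eq_mul]; ring
    change _ ∈ J
    rw [h2]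
    exact h1
  · exact hsub (by simp)
  · exact hsub (by simp [ht])
  · rw [lift_comp_affine (hσ.mdifferentiableAt hJ (hsub (by simp)))]
    have h2 : ∀ r : ℝ, r = 0 → (⟨σ r, t⁻¹ • (lift (E := E) σ r).2⟩ :
        TangentBundle 𝓘(ℝ, E) M) = ⟨p, v⟩ := by
      rintro r rfl
      have h3 : ∀ z : TangentBundle 𝓘(ℝ, E) M, z = ⟨p, t • v⟩ →
        (⟨z.1, t⁻¹ • z.2⟩ : TangentBundle 𝓘(ℝ, E) M) = ⟨p, v⟩ := by
        rintro z rfl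
        rw [smul_smul, inv_mul_cancel₀ ht, one_smul]
      exact h3 _ h0
    exact h2 _ (by simp)

/-- Stability of geodesics on `[0, 1]`: nearby initial velocities have nearby endpoints. -/
theorem eventually_mem_expDomain [FiniteDimensional ℝ E] [T2Space M] {p : M}
    {v : TangentSpace 𝓘(ℝ, E) p} (hv : v ∈ g.expDomain p) {W : Set M}
    (hW : W ∈ 𝓝 (g.exp p v)) : ∀ᶠ w in 𝓝 v, w ∈ g.expDomain p ∧ g.exp p w ∈ W := by
  obtain ⟨γ, hγ⟩ := hv
  obtain ⟨J, σ, hJ, hJc, hsub, heq, hσ, h0⟩ := hγ.exists_solves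
  rw [exp_eq_of_isExpGeodesic hγ, heq] at hW
  have hcont : ContinuousAt (fun w : TangentSpace 𝓘(ℝ, E) p ↦
      (⟨p, w⟩ : TangentBundle 𝓘(ℝ, E) M)) v :=
    (FiberBundle.continuous_totalSpaceMk E (TangentSpace 𝓘(ℝ, E)) p).continuousAt
  have h1 := hσ.dependsContinuously hJ hJc (hsub (by simp : (0 : ℝ) ∈ Icc 0 1))
    (hsub (by simp : (1 : ℝ) ∈ Icc 0 1)) {z | z.1 ∈ W}
    ((FiberBundle.continuous_proj E (TangentSpace 𝓘(ℝ, E))).continuousAt.preimage_mem_nhds hW)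
  rw [h0] at h1
  filter_upwards [hcont.eventually h1] with w hw
  obtain ⟨τ, J', hJ', hJc', h0', h1', hτ, hτ0, hτ1⟩ := hw
  have hexp := isExpGeodesic_of_solves hJ' (hJc'.out h0' h1') hτ hτ0
  refine ⟨⟨τ, hexp⟩, ?_⟩
  rw [exp_eq_of_isExpGeodesic hexp]
  exact hτ1

theorem isOpen_expDomain [FiniteDimensional ℝ E] [T2Space M] (g : LorentzMetric E M) (p : M) :
    IsOpen (g.expDomain p) :=
  isOpen_iff_mem_nhds.2 fun _ hv ↦
    (eventually_mem_expDomain hv Filter.univ_mem).mono fun _ hw ↦ hw.1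

theorem continuousAt_exp [FiniteDimensional ℝ E] [T2Space M] {p : M}
    {v : TangentSpace 𝓘(ℝ, E) p} (hv : v ∈ g.expDomain p) : ContinuousAt (g.exp p) v :=
  fun _ hW ↦ (eventually_mem_expDomain hv hW).mono fun _ hw ↦ hw.2

/-! ### The causal cone -/

theorem continuous_val_self (g : LorentzMetric E M) (p : M) :
    Continuous fun v : TangentSpace 𝓘(ℝ, E) p ↦ g.val p v v := by
  have h : ∀ B : E →L[ℝ] E →L[ℝ] ℝ, Continuous fun v : E ↦ B v v := fun B ↦ by fun_prop
  exact h (g.val p)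

/-- Nonpositivity is a closed condition; conversely, adding a small multiple of a suitable timelike
vector makes such a `v` timelike. -/
theorem mem_causalCone_iff (g : LorentzMetric E M) {p : M} {v : TangentSpace 𝓘(ℝ, E) p} :
    v ∈ g.causalCone p ↔ g.val p v v ≤ 0 := by
  constructor
  · intro h
    have hcl : IsClosed {w : TangentSpace 𝓘(ℝ, E) p | g.val p w w ≤ 0} :=
      isClosed_le (g.continuous_val_self p) continuous_const
    have hsub : {w : TangentSpace 𝓘(ℝ, E) p | g.IsTimelike w} ⊆ {w | g.val p w w ≤ 0} := by
      intro w hw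
      have hw' : g.val p w w < 0 := hw
      exact hw'.le
    exact closure_minimal hsub hcl h
  · intro h
    obtain ⟨w, hw, -⟩ := g.signature p
    -- Replacing `w` by `-w` makes the cross term nonpositive, so `v + ε • w` is timelike for every
    -- `ε > 0`.
    wlog hvw : g.val p v w ≤ 0 generalizing w
    · exact this (-w) (by simpa using hw) (by simpa using le_of_not_ge hvw)
    have hlim : Filter.Tendsto (fun ε : ℝ ↦ v + ε • w) (𝓝[>] 0) (𝓝 v) := by
      have h1 : Continuous fun ε : ℝ ↦ v + ε • w := by fun_prop
      have h2 := h1.tendsto 0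
      rw [zero_smul, add_zero] at h2
      exact h2.mono_left nhdsWithin_le_nhds
    refine mem_closure_of_tendsto hlim ?_
    filter_upwards [self_mem_nhdsWithin] with ε hε
    have hε' : 0 < ε := hε
    have h3 : g.val p (v + ε • w) (v + ε • w) =
        g.val p v v + 2 * (ε * g.val p v w) + ε * ε * g.val p w w := by
      have h4 : ∀ u, g.val p (v + ε • w) u = g.val p v u + ε * g.val p w u := fun u ↦ by
        rw [g.symm, map_add, map_smul, g.symm p u, g.symm p u, smul_eq_mul]
      rw [h4, map_add, map_smul, map_add, map_smul, g.symm p w v]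
      simp only [smul_eq_mul]
      ring
    change g.val p _ _ < 0
    rw [h3]
    have h5 : ε * g.val p v w ≤ 0 := mul_nonpos_of_nonneg_of_nonpos hε'.le hvw
    have h6 : ε * ε * g.val p w w < 0 := mul_neg_of_pos_of_neg (by positivity) hw
    linarith

theorem smul_mem_causalCone {p : M} {v : TangentSpace 𝓘(ℝ, E) p} (h : v ∈ g.causalCone p)
    (a : ℝ) : a • v ∈ g.causalCone p := by
  rw [mem_causalCone_iff] at h ⊢
  have h4 : g.val p (a • v) (a • v) = a * a * g.val p v v := by
    rw [map_smul, g.symm, map_smul, smul_eq_mul, smul_eq_mul, mul_assoc]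
  rw [h4]
  exact mul_nonpos_of_nonneg_of_nonpos (mul_self_nonneg a) h

theorem isCausal_iff {p : M} {v : TangentSpace 𝓘(ℝ, E) p} :
    g.IsCausal v ↔ v ≠ 0 ∧ v ∈ g.causalCone p := by
  rw [mem_causalCone_iff, IsCausal, IsTimelike, IsNull]
  constructor
  · rintro (h | ⟨h, h'⟩)
    · refine ⟨?_, h.le⟩
      rintro rfl
      simp at h
    · exact ⟨h, h'.le⟩
  · rintro ⟨h, h'⟩
    rcases h'.lt_or_eq with h'' | h''
    · exact Or.inl h''
    · exact Or.inr ⟨h, h''⟩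

theorem SolvesGeodesicEq.isCausal [FiniteDimensional ℝ E] [T2Space M] {γ : ℝ → M}
    {J : Set ℝ} (h : g.SolvesGeodesicEq γ J) (hJ : IsOpen J) (hJc : J.OrdConnected) {s t : ℝ}
    (hs : s ∈ J) (ht : t ∈ J) (hc : g.IsCausal (lift (E := E) γ s).2) :
    g.IsCausal (lift (E := E) γ t).2 := by
  rw [isCausal_iff, mem_causalCone_iff] at hc ⊢
  refine ⟨h.velocity_ne_zero hJ hJc hs ht hc.1, ?_⟩
  have h1 := h.energy_eq hJ hJc hs ht
  simp only [energy] at h1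
  rw [← h1]
  exact hc.2

/-! ### Maximal geodesics -/

theorem exists_solves_ray [FiniteDimensional ℝ E] [T2Space M] {p : M} {v : TangentSpace 𝓘(ℝ, E) p}
    {s t : ℝ} (ht : (t - s) • v ∈ g.expDomain p) :
    ∃ (J : Set ℝ) (σ : ℝ → M), IsOpen J ∧ J.OrdConnected ∧ s ∈ J ∧ t ∈ J ∧
      g.SolvesGeodesicEq σ J ∧ lift σ s = (⟨p, v⟩ : TangentBundle 𝓘(ℝ, E) M) := by
  obtain ⟨J, σ, hJ, hJc, h0, htJ, hσ, hl⟩ := exists_solves_of_smul_mem_expDomain ht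
  have hcont : Continuous fun r : ℝ ↦ 1 * r + -s := by fun_prop
  refine ⟨{r | 1 * r + -s ∈ J}, fun r ↦ σ (1 * r + -s), hJ.preimage hcont, ?_, ?_, ?_,
    hσ.comp_affine 1 (-s), ?_⟩
  · refine ⟨fun x hx y hy r hr ↦ hJc.out hx hy ⟨?_, ?_⟩⟩
    · linarith [hr.1]
    · linarith [hr.2]
  · simpa using h0
  · simpa [sub_eq_add_neg] using htJ
  · rw [lift_comp_affine (hσ.mdifferentiableAt hJ (by simpa using h0))]
    have h2 : ∀ r : ℝ, r = 0 → (⟨σ r, (1 : ℝ) • (lift (E := E) σ r).2⟩ :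
        TangentBundle 𝓘(ℝ, E) M) = ⟨p, v⟩ := by
      rintro r rfl
      rw [one_smul]
      exact hl
    exact h2 _ (by simp)

theorem isOpen_ray_dom [FiniteDimensional ℝ E] [T2Space M] (g : LorentzMetric E M) (p : M)
    (v : TangentSpace 𝓘(ℝ, E) p) (s : ℝ) : IsOpen {t : ℝ | (t - s) • v ∈ g.expDomain p} :=
  (g.isOpen_expDomain p).preimage (by fun_prop)

theorem mem_ray_dom [FiniteDimensional ℝ E] (g : LorentzMetric E M) (p : M)
    (v : TangentSpace 𝓘(ℝ, E) p) (s : ℝ) : (s - s) • v ∈ g.expDomain p := by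
  obtain ⟨J, σ, hJ, -, h0, hσ, hl⟩ := exists_solves_zero g ⟨p, (0 : TangentSpace 𝓘(ℝ, E) p)⟩
  have hconst := hσ.comp_affine 0 0
  rw [sub_self, zero_smul]
  refine ⟨_, isExpGeodesic_of_solves (hJ.preimage (by fun_prop : Continuous fun r : ℝ ↦
      (0 : ℝ) * r + 0)) (fun r _ ↦ by simpa using h0) hconst ?_⟩
  rw [lift_comp_affine (hσ.mdifferentiableAt hJ (by simpa using h0))]
  have h2 : ∀ r : ℝ, r = 0 → (⟨σ r, (0 : ℝ) • (lift (E := E) σ r).2⟩ :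
      TangentBundle 𝓘(ℝ, E) M) = ⟨p, 0⟩ := by
    rintro r rfl
    have h3 : ∀ z : TangentBundle 𝓘(ℝ, E) M, z = ⟨p, 0⟩ →
      (⟨z.1, (0 : ℝ) • z.2⟩ : TangentBundle 𝓘(ℝ, E) M) = ⟨p, 0⟩ := by
      rintro z rfl
      rw [zero_smul]
    exact h3 _ hl
  exact h2 _ (by simp)

theorem solvesGeodesicEq_ray [FiniteDimensional ℝ E] [T2Space M] (g : LorentzMetric E M) (p : M)
    (v : TangentSpace 𝓘(ℝ, E) p) (s : ℝ) :
    g.SolvesGeodesicEq (fun t ↦ g.exp p ((t - s) • v)) {t | (t - s) • v ∈ g.expDomain p} := by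
  refine solvesGeodesicEq_of_locally fun t ht ↦ ?_
  obtain ⟨J, σ, hJ, hJc, hs, htJ, hσ, hl⟩ := exists_solves_ray ht
  refine ⟨σ, J, hJ, htJ, hσ, ?_⟩
  filter_upwards [hJ.mem_nhds htJ] with r hr
  exact (hσ.eq_exp hJ hJc hs hr hl).2

theorem ordConnected_ray_dom [FiniteDimensional ℝ E] [T2Space M] (g : LorentzMetric E M) (p : M)
    (v : TangentSpace 𝓘(ℝ, E) p) (s : ℝ) :
    {t : ℝ | (t - s) • v ∈ g.expDomain p}.OrdConnected := by
  have key : ∀ t, (t - s) • v ∈ g.expDomain p → uIcc s t ⊆ {t | (t - s) • v ∈ g.expDomain p} := by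
    intro t ht r hr
    obtain ⟨J, σ, hJ, hJc, hs, htJ, hσ, hl⟩ := exists_solves_ray ht
    exact (hσ.eq_exp hJ hJc hs (hJc.uIcc_subset hs htJ hr) hl).1
  exact ordConnected_of_uIcc_subset_left (x := s) fun t ht ↦ key t ht

theorem lift_ray [FiniteDimensional ℝ E] [T2Space M] (g : LorentzMetric E M) (p : M)
    (v : TangentSpace 𝓘(ℝ, E) p) (s : ℝ) :
    lift (fun t ↦ g.exp p ((t - s) • v)) s = (⟨p, v⟩ : TangentBundle 𝓘(ℝ, E) M) := by
  obtain ⟨J, σ, hJ, hJc, hs, -, hσ, hl⟩ := exists_solves_ray (g.mem_ray_dom p v s)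
  rw [← hl]
  refine lift_congr ?_
  filter_upwards [hJ.mem_nhds hs] with r hr
  exact (hσ.eq_exp hJ hJc hs hr hl).2

theorem nontrivial_of_isOpen {U : Set ℝ} (hU : IsOpen U) {t : ℝ} (ht : t ∈ U) :
    U.Nontrivial := by
  obtain ⟨ε, hε, h⟩ := Metric.isOpen_iff.1 hU t ht
  rw [Real.ball_eq_Ioo] at h
  exact ⟨t, ht, t + ε / 2, h ⟨by linarith, by linarith⟩, by linarith⟩

/-- The maximal geodesic with velocity `v ∈ T_pM` at time `s`. -/
def ray [FiniteDimensional ℝ E] [T2Space M] (g : LorentzMetric E M) (p : M)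
    (v : TangentSpace 𝓘(ℝ, E) p) (s : ℝ) : g.Geodesic where
  toFun t := g.exp p ((t - s) • v)
  dom := {t | (t - s) • v ∈ g.expDomain p}
  ordConnected := g.ordConnected_ray_dom p v s
  nontrivial := nontrivial_of_isOpen (g.isOpen_ray_dom p v s) (g.mem_ray_dom p v s)
  isGeodesicOn := ⟨_, _, g.isOpen_ray_dom p v s, subset_rfl, fun _ _ ↦ rfl,
    g.solvesGeodesicEq_ray p v s⟩

/-- Every geodesic with the given velocity is a restriction of the ray, so extensions can be studied
through `exp` alone. -/
theorem ray_extends [FiniteDimensional ℝ E] [T2Space M] {σ : g.Geodesic} {p : M}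
    {v : TangentSpace 𝓘(ℝ, E) p} {s : ℝ} (hs : s ∈ σ.dom)
    (hv : velocity (E := E) σ.toFun σ.dom s = ⟨p, v⟩) : (g.ray p v s).Extends σ := by
  obtain ⟨J, τ, hJ, hJc, hsub, heq, hτ, hvel⟩ := σ.exists_open
  rw [hvel s hs] at hv
  refine ⟨fun t ht ↦ (hτ.eq_exp hJ hJc (hsub hs) (hsub ht) hv).1, fun t ht ↦ ?_⟩
  rw [heq ht]
  exact (hτ.eq_exp hJ hJc (hsub hs) (hsub ht) hv).2

theorem velocity_ray [FiniteDimensional ℝ E] [T2Space M] (g : LorentzMetric E M) (p : M)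
    (v : TangentSpace 𝓘(ℝ, E) p) (s : ℝ) {t : ℝ} (ht : t ∈ (g.ray p v s).dom) :
    velocity (E := E) (g.ray p v s).toFun (g.ray p v s).dom t = lift (g.ray p v s).toFun t :=
  velocity_eq_lift (g.ray p v s).ordConnected (g.ray p v s).nontrivial (fun _ _ ↦ rfl) ht
    ((g.solvesGeodesicEq_ray p v s).mdifferentiableAt (g.isOpen_ray_dom p v s) ht)

theorem isMaximal_ray [FiniteDimensional ℝ E] [T2Space M] (g : LorentzMetric E M) (p : M)
    (v : TangentSpace 𝓘(ℝ, E) p) (s : ℝ) : (g.ray p v s).IsMaximal := by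
  intro σ hσ
  have hs : s ∈ (g.ray p v s).dom := g.mem_ray_dom p v s
  obtain ⟨J, τ, hJ, hJc, hsub, heq, hτ, -⟩ := σ.exists_open
  have hlift : lift τ s = (⟨p, v⟩ : TangentBundle 𝓘(ℝ, E) M) := by
    rw [← g.lift_ray p v s]
    refine lift_congr ?_
    filter_upwards [(g.isOpen_ray_dom p v s).mem_nhds hs] with t ht
    rw [← heq (hσ.1 ht)]
    exact hσ.2 ht
  exact fun t ht ↦ (hτ.eq_exp hJ hJc (hsub (hσ.1 hs)) (hsub ht) hlift).1

theorem isCausal_ray [FiniteDimensional ℝ E] [T2Space M] (g : LorentzMetric E M) (p : M)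
    {v : TangentSpace 𝓘(ℝ, E) p} (hv : g.IsCausal v) (s : ℝ) : (g.ray p v s).IsCausal := by
  intro t ht
  rw [g.velocity_ray p v s ht]
  refine (g.solvesGeodesicEq_ray p v s).isCausal (g.isOpen_ray_dom p v s)
    (g.ordConnected_ray_dom p v s) (g.mem_ray_dom p v s) ht ?_
  rw [g.lift_ray p v s]
  exact hv

theorem exp_zero [FiniteDimensional ℝ E] [T2Space M] (g : LorentzMetric E M) (p : M) :
    (0 : TangentSpace 𝓘(ℝ, E) p) ∈ g.expDomain p ∧ g.exp p 0 = p := by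
  have h1 := g.mem_ray_dom p 0 0
  have h2 := congrArg (fun z : TangentBundle 𝓘(ℝ, E) M ↦ z.1) (g.lift_ray p 0 0)
  simp only [sub_self, zero_smul, lift] at h1 h2
  exact ⟨h1, h2⟩

theorem ray_mem_causalGeodesicsThrough [FiniteDimensional ℝ E] [T2Space M]
    (g : LorentzMetric E M) (p : M) {v : TangentSpace 𝓘(ℝ, E) p} (hv : g.IsCausal v) (s : ℝ) :
    g.ray p v s ∈ g.causalGeodesicsThrough p := by
  refine ⟨g.isCausal_ray p hv s, g.ray p v s, ⟨subset_rfl, fun _ _ ↦ rfl⟩, s,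
    g.mem_ray_dom p v s, ?_⟩
  change g.exp p ((s - s) • v) = p
  rw [sub_self, zero_smul, (g.exp_zero p).2]

theorem smul_mem_expDomain [FiniteDimensional ℝ E] [T2Space M] {p : M}
    {v : TangentSpace 𝓘(ℝ, E) p} (h : v ∈ g.expDomain p) {t : ℝ} (ht : t ∈ Icc (0 : ℝ) 1) :
    t • v ∈ g.expDomain p := by
  have h0 := g.mem_ray_dom p v 0
  have h1 := (g.ordConnected_ray_dom p v 0).out (x := 0) h0 (y := 1)
    (by simpa using h) ht
  simpa using h1

/-- A geodesic of the collection, extended so as to pass through `p`. -/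
theorem exists_extension_through [FiniteDimensional ℝ E] [T2Space M] {p : M} {γ : g.Geodesic}
    (hγ : γ ∈ g.causalGeodesicsThrough p) :
    ∃ (s : ℝ) (v : TangentSpace 𝓘(ℝ, E) p), g.IsCausal v ∧ (g.ray p v s).Extends γ := by
  obtain ⟨hc, σ, hσ, s, hs, rfl⟩ := hγ
  obtain ⟨J, τ, hJ, hJc, hsub, heq, hτ, hvel⟩ := σ.exists_open
  obtain ⟨t₀, ht₀⟩ := γ.nontrivial.nonempty
  have h1 : velocity (E := E) γ.toFun γ.dom t₀ = lift τ t₀ :=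
    velocity_eq_lift γ.ordConnected γ.nontrivial
      (fun t ht ↦ (hσ.2 ht).symm.trans (heq (hσ.1 ht))) ht₀
      (hτ.mdifferentiableAt hJ (hsub (hσ.1 ht₀)))
  have h2 := hc t₀ ht₀
  rw [h1] at h2
  have h3 := hτ.isCausal hJ hJc (hsub (hσ.1 ht₀)) (hsub hs) h2
  rw [← hvel s hs] at h3
  have h4 := ray_extends (p := σ.toFun s) (v := (velocity (E := E) σ.toFun σ.dom s).2) hs rfl
  exact ⟨s, _, h3, hσ.1.trans h4.1, fun t ht ↦ (h4.2 (hσ.1 ht)).trans (hσ.2 ht)⟩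

/-- Both geodesics share the velocity of `γ` at some time, hence are restrictions of the same ray;
by maximality they fill its domain. -/
theorem Geodesic.IsMaximal.eq_of_extends [FiniteDimensional ℝ E] [T2Space M]
    {γ σ τ : g.Geodesic} (hσ : σ.IsMaximal) (hσγ : σ.Extends γ) (hτ : τ.IsMaximal)
    (hτγ : τ.Extends γ) : σ.dom = τ.dom ∧ EqOn σ.toFun τ.toFun σ.dom := by
  obtain ⟨t₀, ht₀⟩ := γ.nontrivial.nonempty
  have key : ∀ ρ : g.Geodesic, ρ.Extends γ → velocity (E := E) ρ.toFun ρ.dom t₀ =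
      ⟨(velocity (E := E) γ.toFun γ.dom t₀).1, (velocity (E := E) γ.toFun γ.dom t₀).2⟩ := by
    intro ρ hρ
    obtain ⟨J, r, hJ, hJc, hsub, heq, hr, hvel⟩ := ρ.exists_open
    rw [hvel t₀ (hρ.1 ht₀)]
    exact (velocity_eq_lift γ.ordConnected γ.nontrivial
      (fun t ht ↦ (hρ.2 ht).symm.trans (heq (hρ.1 ht))) ht₀
      (hr.mdifferentiableAt hJ (hsub (hρ.1 ht₀)))).symm
  have h1 := ray_extends (hσγ.1 ht₀) (key σ hσγ)
  have h2 := ray_extends (hτγ.1 ht₀) (key τ hτγ)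
  have h3 := subset_antisymm h1.1 (hσ _ h1)
  have h4 := subset_antisymm h2.1 (hτ _ h2)
  refine ⟨h3.trans h4.symm, fun t ht ↦ ?_⟩
  rw [← h1.2 ht, ← h2.2 (by rwa [h4, ← h3])]

/-! ### Properness implies disprisonment and pseudoconvexity -/

/-- The preimage of `K` under `exp_p|_{C_p}`, as a subset of the model space. -/
def causalPreimage (g : LorentzMetric E M) (p : M) (K : Set M) : Set E :=
  {v : E | (v : TangentSpace 𝓘(ℝ, E) p) ∈ g.causalExpDomain p ∧ g.exp p v ∈ K}

theorem hasCompactPreimages_causalExp_iff (g : LorentzMetric E M) (p : M) :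
    HasCompactPreimages (g.causalExp p) ↔
      ∀ K : Set M, IsCompact K → IsCompact (g.causalPreimage p K) := by
  refine forall₂_congr fun K _ ↦ ?_
  rw [Subtype.isCompact_iff]
  have : (Subtype.val '' (g.causalExp p ⁻¹' K) : Set (TangentSpace 𝓘(ℝ, E) p)) =
      g.causalPreimage p K := by
    ext v
    constructor
    · rintro ⟨w, hw, rfl⟩
      exact ⟨w.2, hw⟩
    · rintro ⟨hv, hv'⟩
      exact ⟨⟨v, hv⟩, hv', rfl⟩
  rw [this]
  rfl

/-- If the causal exponential map is proper, no causal ray from `p` is imprisoned in a compact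
set. -/
theorem not_imprisoned_of_isCompact [FiniteDimensional ℝ E] [T2Space M] {p : M} {K : Set M}
    (hK : IsCompact (g.causalPreimage p K)) {v : TangentSpace 𝓘(ℝ, E) p} (hv : g.IsCausal v)
    (hmem : ∀ t : ℝ, 0 ≤ t → t • v ∈ g.expDomain p → g.exp p (t • v) ∈ K) : False := by
  rw [isCausal_iff] at hv
  obtain ⟨w, hwv⟩ : ∃ w : E, w = v := ⟨v, rfl⟩
  have hw0 : w ≠ 0 := by rw [hwv]; exact hv.1
  set T : Set ℝ := {t | 0 ≤ t ∧ t • v ∈ g.expDomain p}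
  have hT : ∀ t ∈ T, t • w ∈ g.causalPreimage p K := fun t ht ↦ by
    rw [hwv]
    exact ⟨⟨smul_mem_causalCone hv.2 t, ht.2⟩, hmem t ht.1 ht.2⟩
  have hcont : Continuous fun t : ℝ ↦ t • w := by fun_prop
  obtain ⟨R, hR⟩ := hK.isBounded.exists_norm_le
  have hbdd : BddAbove T := by
    refine ⟨R / ‖w‖, fun t ht ↦ ?_⟩
    have h1 := hR _ (hT t ht)
    rw [norm_smul, Real.norm_of_nonneg ht.1] at h1
    rwa [le_div_iff₀ (norm_pos_iff.2 hw0)]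
  have h0 : (0 : ℝ) ∈ T := ⟨le_rfl, by rw [zero_smul]; exact (g.exp_zero p).1⟩
  have hsup := csSup_mem_closure ⟨0, h0⟩ hbdd
  -- Compactness of the preimage puts the endpoint of the ray inside the domain of `exp_p`, which is
  -- open, so the ray continues past its supremum.
  have hlim : sSup T • w ∈ g.causalPreimage p K :=
    closure_minimal (t := (fun t : ℝ ↦ t • w) ⁻¹' g.causalPreimage p K)
      (fun t ht ↦ hT t ht) (hK.isClosed.preimage hcont) hsup
  rw [hwv] at hlim
  have hopen : IsOpen {t : ℝ | t • v ∈ g.expDomain p} := by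
    simpa using g.isOpen_ray_dom p v 0
  have hlt : ∀ᶠ t in 𝓝 (sSup T), t • v ∈ g.expDomain p := hopen.mem_nhds hlim.1.2
  obtain ⟨ε, hε, hball⟩ := Metric.eventually_nhds_iff_ball.1 hlt
  have h2 : sSup T + ε / 2 ∈ T := by
    refine ⟨by linarith [le_csSup hbdd h0], hball _ ?_⟩
    rw [Real.ball_eq_Ioo]
    constructor <;> linarith
  linarith [le_csSup hbdd h2]

theorem isCompact_ray_image [FiniteDimensional ℝ E] [T2Space M] {p : M}
    {v : TangentSpace 𝓘(ℝ, E) p} {s t : ℝ} (ht : t ∈ (g.ray p v s).dom) :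
    IsCompact ((g.ray p v s).toFun '' uIcc s t) :=
  isCompact_uIcc.image_of_continuousOn
    ((g.solvesGeodesicEq_ray p v s).1.continuousOn.mono
      ((g.ordConnected_ray_dom p v s).uIcc_subset (g.mem_ray_dom p v s) ht))

theorem disprisoning_of_proper [FiniteDimensional ℝ E] [T2Space M] {p : M}
    (h : ∀ K : Set M, IsCompact K → IsCompact (g.causalPreimage p K)) :
    Disprisoning (g.causalGeodesicsThrough p) := by
  intro γ hγ σ hσ hmax t₀ ht₀
  obtain ⟨s, v, hv, hext⟩ := exists_extension_through hγ
  obtain ⟨hdom, heq⟩ := hmax.eq_of_extends hσ (g.isMaximal_ray p v s) hext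
  have ht₀' := ht₀
  rw [hdom] at ht₀'
  have hv' := isCausal_iff.1 hv
  have hneg : g.IsCausal (-v) := isCausal_iff.2
    ⟨neg_ne_zero.2 hv'.1, by simpa using smul_mem_causalCone hv'.2 (-1)⟩
  have hmem : ∀ t : ℝ, t • v ∈ g.expDomain p → s + t ∈ σ.dom ∧
      σ.toFun (s + t) = g.exp p (t • v) := by
    intro t ht
    have h1 : s + t ∈ (g.ray p v s).dom := by
      change (s + t - s) • v ∈ g.expDomain p
      rwa [add_sub_cancel_left]
    refine ⟨hdom ▸ h1, ?_⟩
    rw [heq (hdom ▸ h1)]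
    change g.exp p ((s + t - s) • v) = _
    rw [add_sub_cancel_left]
  have hint : ∀ r ∈ uIcc s t₀, σ.toFun r ∈ (g.ray p v s).toFun '' uIcc s t₀ := by
    intro r hr
    refine ⟨r, hr, (heq ?_).symm⟩
    rw [hdom]
    exact (g.ordConnected_ray_dom p v s).uIcc_subset (g.mem_ray_dom p v s) ht₀' hr
  constructor
  · intro hc
    -- The closure only controls times beyond `t₀`, while the ray starts at `p` at time `s`; the
    -- compact arc between these two times is added.
    refine not_imprisoned_of_isCompact (h _ (hc.union (isCompact_ray_image ht₀'))) hv
      fun t ht0 ht ↦ ?_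
    obtain ⟨h1, h2⟩ := hmem t ht
    rw [← h2]
    rcases le_total t₀ (s + t) with hle | hle
    · exact Or.inl (subset_closure ⟨_, ⟨h1, hle⟩, rfl⟩)
    · exact Or.inr (hint _ (mem_uIcc.2 (Or.inl ⟨by linarith, hle⟩)))
  · intro hc
    -- The past end is the future ray of `-v`, which is causal too.
    refine not_imprisoned_of_isCompact (h _ (hc.union (isCompact_ray_image ht₀'))) hneg
      fun t ht0 ht ↦ ?_
    rw [smul_neg, ← neg_smul] at ht ⊢
    obtain ⟨h1, h2⟩ := hmem (-t) ht
    rw [← h2]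
    rcases le_total (s + -t) t₀ with hle | hle
    · exact Or.inl (subset_closure ⟨_, ⟨h1, hle⟩, rfl⟩)
    · exact Or.inr (hint _ (mem_uIcc.2 (Or.inr ⟨hle, by linarith⟩)))

theorem pseudoconvex_of_proper [FiniteDimensional ℝ E] [T2Space M] {p : M}
    (h : ∀ K : Set M, IsCompact K → IsCompact (g.causalPreimage p K)) :
    Pseudoconvex (g.causalGeodesicsThrough p) := by
  intro K hK
  have hA := h K hK
  -- The cone over the preimage with apex 0: compact, and inside the star-shaped domain of `exp_p`.
  set S : Set E := (fun x : ℝ × E ↦ x.1 • x.2) '' (Icc (0 : ℝ) 1 ×ˢ g.causalPreimage p K)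
  have hS : IsCompact S := (isCompact_Icc.prod hA).image (by fun_prop)
  have hSD : S ⊆ g.expDomain p := by
    rintro _ ⟨⟨t, w⟩, ⟨ht, hw⟩, rfl⟩
    exact smul_mem_expDomain hw.1.2 ht
  have hcont : @ContinuousOn E M _ _ (g.exp p) S := fun w hw ↦
    (continuousAt_exp (hSD hw)).continuousWithinAt
  refine ⟨g.exp p '' S, hS.image_of_continuousOn hcont, ?_⟩
  rintro γ hγ a b hab hsub ha hb _ ⟨r, hr, rfl⟩
  obtain ⟨s, v, hv, hext⟩ := exists_extension_through hγ
  have hv' := isCausal_iff.1 hv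
  have hpre : ∀ c ∈ γ.dom, γ.toFun c ∈ K → ((c - s) • (v : E)) ∈ g.causalPreimage p K := by
    intro c hc hcK
    refine ⟨⟨smul_mem_causalCone hv'.2 _, hext.1 hc⟩, ?_⟩
    rw [← hext.2 hc] at hcK
    exact hcK
  have hseg : ∀ c, ((c - s) • (v : E)) ∈ g.causalPreimage p K → ∀ θ ∈ Icc (0 : ℝ) 1,
      r - s = θ * (c - s) → γ.toFun r ∈ g.exp p '' S := by
    intro c hc θ hθ hrθ
    refine ⟨(r - s) • (v : E), ⟨(θ, (c - s) • (v : E)), ⟨hθ, hc⟩, ?_⟩, hext.2 (hsub hr)⟩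
    simp only [hrθ, mul_smul]
    rfl
  have hdiv : ∀ x y : ℝ, 0 ≤ x → x ≤ y → ∃ θ ∈ Icc (0 : ℝ) 1, x = θ * y := by
    intro x y hx hxy
    rcases hx.eq_or_lt with rfl | hx'
    · exact ⟨0, by simp, by simp⟩
    · have hy : 0 < y := hx'.trans_le hxy
      exact ⟨x / y, ⟨by positivity, (div_le_one hy).2 hxy⟩, by field_simp⟩
  -- The parameter `r` lies between `s` and one endpoint: `b` if `r` is after `s`, and `a`
  -- otherwise. Thus `(r - s)v` is on the radial segment to the vector of that endpoint, even if the
  -- segment misses `p`.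
  rcases le_total s r with hsr | hsr
  · obtain ⟨θ, hθ, hθ'⟩ := hdiv (r - s) (b - s) (by linarith) (by linarith [hr.2])
    exact hseg b (hpre b (hsub (right_mem_Icc.2 hab)) hb) θ hθ hθ'
  · obtain ⟨θ, hθ, hθ'⟩ := hdiv (s - r) (s - a) (by linarith) (by linarith [hr.1])
    exact hseg a (hpre a (hsub (left_mem_Icc.2 hab)) ha) θ hθ (by linarith)

/-! ### Pseudoconvexity and disprisonment imply properness -/

theorem isClosed_causalCone (g : LorentzMetric E M) (p : M) : IsClosed (g.causalCone p) :=
  isClosed_closure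

/-- Under disprisonment, no causal ray from `p` is a limit of points that are mapped into a
compact set. -/
theorem not_imprisoned_of_disprisoning [FiniteDimensional ℝ E] [T2Space M] {p : M}
    (h : Disprisoning (g.causalGeodesicsThrough p)) {K : Set M} (hK : IsCompact K)
    {v : TangentSpace 𝓘(ℝ, E) p} (hv : g.IsCausal v)
    (hmem : ∀ t : ℝ, 0 ≤ t → t • v ∈ g.expDomain p →
      t • v ∈ closure {w | w ∈ g.expDomain p ∧ g.exp p w ∈ K}) : False := by
  have h1 := (h _ (g.ray_mem_causalGeodesicsThrough p hv 0) _ ⟨subset_rfl, fun _ _ ↦ rfl⟩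
    (g.isMaximal_ray p v 0) 0 (g.mem_ray_dom p v 0)).1
  refine h1 (hK.of_isClosed_subset isClosed_closure (closure_minimal ?_ hK.isClosed))
  rintro _ ⟨t, ⟨ht, ht0⟩, rfl⟩
  have ht' : t • v ∈ g.expDomain p := by simpa [ray] using ht
  have h2 := hmem t ht0 ht'
  have h3 : ContinuousAt (g.exp p) (t • v) :=
    continuousAt_exp ht'
  have h4 : (g.ray p v 0).toFun t = g.exp p (t • v) := by simp [ray]
  rw [h4]
  have h5 := h3.continuousWithinAt.mem_closure h2 (t := K) fun w hw ↦ hw.2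
  rwa [hK.isClosed.closure_eq] at h5

theorem proper_of_pseudoconvex_disprisoning [FiniteDimensional ℝ E] [T2Space M] {p : M}
    (hpc : Pseudoconvex (g.causalGeodesicsThrough p))
    (hdis : Disprisoning (g.causalGeodesicsThrough p)) (K : Set M) (hK : IsCompact K) :
    IsCompact (g.causalPreimage p K) := by
  have : ProperSpace E := FiniteDimensional.proper ℝ E
  -- The segments to be controlled start at `p`, so `p` has to belong to the compact set.
  obtain ⟨K', hK', hseg⟩ := hpc (insert p K) (hK.insert p)
  have hmem : ∀ w ∈ g.causalPreimage p K, ∀ t ∈ Icc (0 : ℝ) 1,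
      (t • w ∈ g.expDomain p ∧ g.exp p (t • w) ∈ insert p K') := by
    intro w hw t ht
    refine ⟨smul_mem_expDomain hw.1.2 ht, ?_⟩
    -- The zero vector belongs to the closed cone but is not causal; its constant curve is the
    -- reason for adding `p` to `K'`.
    rcases eq_or_ne (w : TangentSpace 𝓘(ℝ, E) p) 0 with h0 | h0
    · left
      have h1 : t • w = (0 : TangentSpace 𝓘(ℝ, E) p) := by
        change t • (w : TangentSpace 𝓘(ℝ, E) p) = 0
        rw [h0, smul_zero]
      rw [h1, (g.exp_zero p).2]
    · right
      have hc : g.IsCausal (x := p) w := isCausal_iff.2 ⟨h0, hw.1.1⟩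
      have hval : ∀ r, (g.ray p w 0).toFun r = g.exp p (r • w) := fun r ↦ by
        change g.exp p ((r - 0) • w) = _
        rw [sub_zero]
      have hdom : Icc (0 : ℝ) 1 ⊆ (g.ray p w 0).dom := fun r hr ↦ by
        change (r - 0) • w ∈ g.expDomain p
        rw [sub_zero]
        exact smul_mem_expDomain hw.1.2 hr
      have h2 := hseg _ (g.ray_mem_causalGeodesicsThrough p hc 0) 0 1 zero_le_one hdom
        (by
          rw [hval]
          left
          have h1 : (0 : ℝ) • w = (0 : TangentSpace 𝓘(ℝ, E) p) := zero_smul ℝ w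
          rw [h1, (g.exp_zero p).2])
        (by
          rw [hval, one_smul]
          exact Or.inr hw.2)
      rw [← hval]
      exact h2 ⟨t, ht, rfl⟩
  have hKp := hK'.insert p
  have hcone : IsClosed (g.causalCone p : Set E) := g.isClosed_causalCone p
  have hclosed : IsClosed (g.causalPreimage p K) := by
    rw [← closure_subset_iff_isClosed]
    intro w hw
    have hwc : w ∈ (g.causalCone p : Set E) :=
      closure_minimal (fun x hx ↦ hx.1.1) hcone hw
    have hwD : (w : TangentSpace 𝓘(ℝ, E) p) ∈ g.expDomain p := by
      by_contra hnot
      have h0 : (w : TangentSpace 𝓘(ℝ, E) p) ≠ 0 := by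
        intro h0
        rw [h0] at hnot
        exact hnot (g.exp_zero p).1
      refine not_imprisoned_of_disprisoning hdis hKp (isCausal_iff.2 ⟨h0, hwc⟩) fun t ht htD ↦ ?_
      -- The ray along `w` stops before time 1, so each of its points `t • w` is a limit of `t • x`
      -- with `x` in the preimage and `t ≤ 1`, where `hmem` applies.
      have ht1 : t ≤ 1 := by
        by_contra hlt
        push Not at hlt
        have haux : ∀ x : TangentSpace 𝓘(ℝ, E) p, t • x ∈ g.expDomain p →
            x ∈ g.expDomain p := by
          intro x hx
          have := smul_mem_expDomain hx (t := t⁻¹)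
            ⟨by positivity, inv_le_one_of_one_le₀ hlt.le⟩
          rwa [smul_smul, inv_mul_cancel₀ (by positivity), one_smul] at this
        exact hnot (haux w htD)
      have hcont : Continuous fun x : E ↦ t • x := by fun_prop
      have h3 := hcont.continuousWithinAt.mem_closure hw
        (t := {x : E | x ∈ g.expDomain p ∧ g.exp p x ∈ insert p K'})
        fun x hx ↦ hmem x hx t ⟨ht, ht1⟩
      exact h3
    refine ⟨⟨hwc, hwD⟩, ?_⟩
    have h3 : @ContinuousAt E M _ _ (g.exp p) w :=
      continuousAt_exp hwD
    have h5 := h3.continuousWithinAt.mem_closure hw (t := K) fun x hx ↦ hx.2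
    rwa [hK.isClosed.closure_eq] at h5
  refine Metric.isCompact_of_isClosed_isBounded hclosed ?_
  by_contra hunb
  -- The `+ 1` keeps the norms positive, so the vectors can be normalized and a limit direction `u`
  -- extracted.
  have hex : ∀ n : ℕ, ∃ w ∈ g.causalPreimage p K, (n : ℝ) + 1 < ‖w‖ := by
    intro n
    by_contra hcon
    push Not at hcon
    exact hunb (isBounded_iff_forall_norm_le.2 ⟨_, hcon⟩)
  choose w hw hwn using hex
  have hpos : ∀ n, 0 < ‖w n‖ := fun n ↦ lt_of_le_of_lt (by positivity) (hwn n)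
  have hsphere : ∀ n, ‖w n‖⁻¹ • w n ∈ Metric.sphere (0 : E) 1 := fun n ↦ by
    rw [mem_sphere_zero_iff_norm, norm_smul, norm_inv, norm_norm, inv_mul_cancel₀ (hpos n).ne']
  obtain ⟨u, hu, φ, hφ, hlim⟩ := (isCompact_sphere (0 : E) 1).tendsto_subseq hsphere
  have hu0 : u ≠ 0 := by
    rintro rfl
    simp at hu
  have huc : u ∈ (g.causalCone p : Set E) := hcone.mem_of_tendsto hlim
    (Filter.Eventually.of_forall fun n ↦ smul_mem_causalCone (hw _).1.1 _)
  refine not_imprisoned_of_disprisoning hdis hKp (v := u) (isCausal_iff.2 ⟨hu0, huc⟩)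
    fun t ht _ ↦ ?_
  have h6 : t • u ∈ closure {x : E | x ∈ g.expDomain p ∧ g.exp p x ∈ insert p K'} := by
    refine mem_closure_of_tendsto (hlim.const_smul t) ?_
    filter_upwards [Filter.eventually_ge_atTop ⌈t⌉₊] with n hn
    have h7 : t ≤ ‖w (φ n)‖ := by
      have h8 : (⌈t⌉₊ : ℝ) ≤ φ n := by exact_mod_cast hn.trans (hφ.id_le n)
      linarith [Nat.le_ceil t, hwn (φ n)]
    -- Once the norm of `w (φ n)` exceeds `t`, the vector of length `t` in its direction is on the
    -- trapped radial segment; these vectors converge to `t • u`.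
    have h9 := hmem (w (φ n)) (hw _) (t * ‖w (φ n)‖⁻¹)
      ⟨by positivity, by rw [← div_eq_mul_inv]; exact (div_le_one (hpos _)).2 h7⟩
    rw [mul_smul] at h9
    exact h9
  exact h6

/-! ### Passage from all causal geodesics to those through a point -/

theorem causalGeodesicsThrough_subset (g : LorentzMetric E M) (p : M) :
    g.causalGeodesicsThrough p ⊆ g.causalGeodesics := fun _ h ↦ h.1

theorem Pseudoconvex.mono {C C' : Set g.Geodesic} (h : Pseudoconvex C') (hC : C ⊆ C') :
    Pseudoconvex C := fun K hK ↦ by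
  obtain ⟨K', hK', h'⟩ := h K hK
  exact ⟨K', hK', fun γ hγ ↦ h' γ (hC hγ)⟩

theorem Disprisoning.mono {C C' : Set g.Geodesic} (h : Disprisoning C') (hC : C ⊆ C') :
    Disprisoning C := fun γ hγ ↦ h γ (hC hγ)

end LorentzMetric

end

theorem corollary3p6 {E : Type*} [NormedAddCommGroup E] [NormedSpace ℝ E] [FiniteDimensional ℝ E]
    {M : Type*} [TopologicalSpace M] [T2Space M] [SecondCountableTopology M] [ConnectedSpace M]
    [ChartedSpace E M] [IsManifold 𝓘(ℝ, E) ∞ M] (hdim : 2 ≤ Module.finrank ℝ E)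
    (g : LorentzMetric E M) :
    (∀ p : M,
      (LorentzMetric.Pseudoconvex (g.causalGeodesicsThrough p) ∧
        LorentzMetric.Disprisoning (g.causalGeodesicsThrough p)) ↔
      HasCompactPreimages (g.causalExp p)) ∧
    (LorentzMetric.Pseudoconvex g.causalGeodesics ∧ LorentzMetric.Disprisoning g.causalGeodesics →
      ∀ q : M, HasCompactPreimages (g.causalExp q)) := by
  have key : ∀ p : M, (LorentzMetric.Pseudoconvex (g.causalGeodesicsThrough p) ∧
      LorentzMetric.Disprisoning (g.causalGeodesicsThrough p)) ↔
      HasCompactPreimages (g.causalExp p) := by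
    intro p
    rw [LorentzMetric.hasCompactPreimages_causalExp_iff]
    exact ⟨fun h ↦ LorentzMetric.proper_of_pseudoconvex_disprisoning h.1 h.2, fun h ↦
      ⟨LorentzMetric.pseudoconvex_of_proper h, LorentzMetric.disprisoning_of_proper h⟩⟩
  refine ⟨key, fun h q ↦ (key q).1 ⟨?_, ?_⟩⟩
  · exact h.1.mono (g.causalGeodesicsThrough_subset q)
  · exact h.2.mono (g.causalGeodesicsThrough_subset q)
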